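/- **Theorem (Strong completeness of first-order Fischer Servi logic $\mathsf{FOFS}$).** *Language.* A signature consists of a countably infinite set of constants and a countable set of predicate symbols, each with a positive arity. Terms are constants and variables $v_0,v_1,\dots$. Formulas are given by $$\varphi ::= P(t_1,\dots,t_n)\mid s\equiv t\mid \varphi\wedge\varphi\mid\varphi\vee\varphi\mid\varphi\to\varphi\mid\Box\varphi\mid\Diamond\varphi\mid\forall x\,\varphi\mid\exists x\,\varphi\mid\bot ,$$ with $\neg\varphi:=\varphi\to\bot$, $\top:=\neg\bot$, and $\varphi\leftrightarrow\psi:=(\varphi\to\psi)\wedge(\psi\to\varphi)$. A sentence is a formula without free variables. We write $\varphi(x)$ for a formula in which no variable other than $x$ occurs free ($x$ itself need not occur), and $\varphi(c)$ for the sentence obtained by replacing each free occurrence of $x$ by the constant $c$. *Hilbert system.* $\vdash$ is the least set of sentences containing the following axioms and closed under the following rules ($\varphi,\psi$ are sentences where no variable is displayed): * all substitution instances, by sentences, of theorems of intuitionistic propositional logic; * $\Box(\varphi\wedge\psi)\leftrightarrow(\Box\varphi\wedge\Box\psi)$, $\ \Box\top$, $\ \Diamond(\varphi\vee\psi)\leftrightarrow(\Diamond\varphi\vee\Diamond\psi)$,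 $\ \neg\Diamond\bot$; * $(\Diamond\varphi\to\Box\psi)\to\Box(\varphi\to\psi)$ and $\Diamond(\varphi\to\psi)\to(\Box\varphi\to\Diamond\psi)$; * $\forall x\,\varphi(x)\to\varphi(c)$, $\ \varphi(c)\to\exists x\,\varphi(x)$, $\ \forall x(\varphi(x)\to\psi)\to(\exists x\,\varphi(x)\to\psi)$, $\ \forall x(\varphi\to\psi(x))\to(\varphi\to\forall x\,\psi(x))$; * $c\equiv c$, and $c_1\equiv c_2\to(\varphi(c_1)\to\varphi(c_2))$ for $\varphi(x)$ containing neither $\Box$ nor $\Diamond$; * modus ponens; from $\varphi\to\psi$ infer $\Box\varphi\to\Box\psi$ and $\Diamond\varphi\to\Diamond\psi$; from a sentence $\varphi$ infer $\forall x\,\varphi^c_x$, where $\varphi^c_x$ is $\varphi$ with every occurrence of the constant $c$ replaced by $x$, provided that no occurrence of $c$ in $\varphi$ lies in the scope of a quantifier binding $x$. For a set $\Gamma$ of sentences, $\Gamma\vdash\varphi$ means that $\vdash\bigwedge_i\gamma_i\to\varphi$ for some finite $\{\gamma_i\}_i\subseteq\Gamma$, where the empty conjunction is $\top$. *Models.*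 A model consists of * a set $W$ with a partial order $\preccurlyeq$ and a binary relation $M$ such that: if $wMv\preccurlyeq v'$, then $w\preccurlyeq w'Mv'$ for some $w'$; and if $w\preccurlyeq w'$ and $wMv$, then $v\preccurlyeq v'$ and $w'Mv'$ for some $v'$; * a set $D(w)$ for each $w\in W$ with $D(w)\subseteq D(w')$ whenever $w\preccurlyeq w'$ or $wMw'$; * an equivalence relation $\sim_w$ on $D(w)$ for each $w\in W$ with $\sim_w\,\subseteq\,\sim_{w'}$ whenever $w\preccurlyeq w'$; * for each constant $c$ an element $I(c)$ lying in $D(w)$ for every $w$; * for each world $w$ and $n$-ary $P$ a set $I_w(P)\subseteq D(w)^n$, invariant under coordinatewise $\sim_w$, with $I_w(P)\subseteq I_{w'}(P)$ whenever $w\preccurlyeq w'$. Truth $w\Vdash_g\varphi$ is defined for $g:\{v_0,v_1,\dots\}\to D(w)$. Write $t^g$ for the denotation of the term $t$: $c^g=I(c)$ for a constant and $x^g=g(x)$ for a variable. Then $w\Vdash_g P(t_1,\dots,t_n)$ iff $(t_1^g,\dots,t_n^g)\in I_w(P)$, and $w\Vdash_g s\equiv t$ iff $s^g\sim_w t^g$.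 The clauses for $\wedge,\vee,\bot$ are the classical ones. The remaining clauses are: * $w\Vdash_g\varphi\to\psi$ iff for all $w'\succcurlyeq w$, $w'\Vdash_g\varphi$ implies $w'\Vdash_g\psi$; * $w\Vdash_g\Box\varphi$ iff $v\Vdash_g\varphi$ for all $w',v$ with $w\preccurlyeq w'Mv$; * $w\Vdash_g\Diamond\varphi$ iff $v\Vdash_g\varphi$ for some $v$ with $wMv$; * $w\Vdash_g\forall x\,\varphi$ iff $w'\Vdash_{g[x:=a]}\varphi$ for all $w'\succcurlyeq w$ and all $a\in D(w')$; * $w\Vdash_g\exists x\,\varphi$ iff $w\Vdash_{g[x:=a]}\varphi$ for some $a\in D(w)$. A sentence is true at $w$ if it is true at $w$ under every such $g$. $\Gamma\Vdash\varphi$ means that $\varphi$ is true at every world of every model at which all members of $\Gamma$ are true. *Claim.* For every signature, every set $\Gamma$ of sentences and every sentence $\varphi$: if $\Gamma\Vdash\varphi$, then $\Gamma\vdash\varphi$. -/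

import Mathlib

universe u

namespace FOFS

/-! ## The language -/

/-- A signature: a countably infinite set of constants and a countable set of predicate symbols,
each with a positive arity. -/
structure Signature where
  Const : Type u
  Pred : Type u
  arity : Pred → ℕ
  countable_const : Countable Const
  infinite_const : Infinite Const
  countable_pred : Countable Pred
  arity_pos : ∀ P, 0 < arity P

/-- Terms are constants and variables; the variables are `v₀, v₁, …`, indexed by `ℕ`. -/
inductive Term (σ : Signature.{u}) : Type u
  | const (c : σ.Const) : Term σ
  | var (x : ℕ) : Term σ

inductive Formula (σ : Signature.{u}) : Type u
  | rel (P : σ.Pred) (ts : Fin (σ.arity P) → Term σ) : Formula σ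
  | eq (s t : Term σ) : Formula σ
  | and (φ ψ : Formula σ) : Formula σ
  | or (φ ψ : Formula σ) : Formula σ
  | imp (φ ψ : Formula σ) : Formula σ
  | box (φ : Formula σ) : Formula σ
  | dia (φ : Formula σ) : Formula σ
  | all (x : ℕ) (φ : Formula σ) : Formula σ
  | ex (x : ℕ) (φ : Formula σ) : Formula σ
  | bot : Formula σ

variable {σ : Signature.{u}}

namespace Term

def freeVars : Term σ → Finset ℕ
  | const _ => ∅
  | var x => {x}

/-- The term `t` with the variable `x` replaced by the constant `c`. -/
def subst (x : ℕ) (c : σ.Const) : Term σ → Term σ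
  | const d => const d
  | var y => if y = x then const c else var y

/-- The term `t` with the constant `c` replaced by the variable `x`. -/
noncomputable def replaceConst (c : σ.Const) (x : ℕ) : Term σ → Term σ
  | const d => open Classical in if d = c then var x else const d
  | var y => var y

/-- The constant `c` occurs in the term. -/
def HasConst (c : σ.Const) : Term σ → Prop
  | const d => d = c
  | var _ => False

end Term

namespace Formula

def neg (φ : Formula σ) : Formula σ := imp φ bot

def iff (φ ψ : Formula σ) : Formula σ := and (imp φ ψ) (imp ψ φ)

def top : Formula σ := neg bot

/-- The conjunction of a finite list of formulas (`⊤` for the empty list). -/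
def conj : List (Formula σ) → Formula σ
  | [] => top
  | φ :: L => and φ (conj L)

def freeVars : Formula σ → Finset ℕ
  | rel _ ts => Finset.univ.biUnion fun i => (ts i).freeVars
  | eq s t => s.freeVars ∪ t.freeVars
  | and φ ψ => φ.freeVars ∪ ψ.freeVars
  | or φ ψ => φ.freeVars ∪ ψ.freeVars
  | imp φ ψ => φ.freeVars ∪ ψ.freeVars
  | box φ => φ.freeVars
  | dia φ => φ.freeVars
  | all x φ => φ.freeVars.erase x
  | ex x φ => φ.freeVars.erase x
  | bot => ∅

def IsSentence (φ : Formula σ) : Prop := φ.freeVars = ∅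

/-- No variable other than `x` is free in `φ`, so that `φ` may be written `φ(x)`. -/
def FreeOnlyIn (x : ℕ) (φ : Formula σ) : Prop := φ.freeVars ⊆ {x}

/-- `φ(c)`: every free occurrence of the variable `x` in `φ` is replaced by the constant `c`. -/
def subst (x : ℕ) (c : σ.Const) : Formula σ → Formula σ
  | rel P ts => rel P fun i => (ts i).subst x c
  | eq s t => eq (s.subst x c) (t.subst x c)
  | and φ ψ => and (φ.subst x c) (ψ.subst x c)
  | or φ ψ => or (φ.subst x c) (ψ.subst x c)
  | imp φ ψ => imp (φ.subst x c) (ψ.subst x c)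
  | box φ => box (φ.subst x c)
  | dia φ => dia (φ.subst x c)
  | all y φ => if y = x then all y φ else all y (φ.subst x c)
  | ex y φ => if y = x then ex y φ else ex y (φ.subst x c)
  | bot => bot

/-- `φ` with each occurrence of the constant `c` replaced by the variable `x`. -/
noncomputable def replaceConst (c : σ.Const) (x : ℕ) : Formula σ → Formula σ
  | rel P ts => rel P fun i => (ts i).replaceConst c x
  | eq s t => eq (s.replaceConst c x) (t.replaceConst c x)
  | and φ ψ => and (φ.replaceConst c x) (ψ.replaceConst c x)
  | or φ ψ => or (φ.replaceConst c x) (ψ.replaceConst c x)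
  | imp φ ψ => imp (φ.replaceConst c x) (ψ.replaceConst c x)
  | box φ => box (φ.replaceConst c x)
  | dia φ => dia (φ.replaceConst c x)
  | all y φ => all y (φ.replaceConst c x)
  | ex y φ => ex y (φ.replaceConst c x)
  | bot => bot

/-- The constant `c` occurs in the formula. -/
def HasConst (c : σ.Const) : Formula σ → Prop
  | rel _ ts => ∃ i, (ts i).HasConst c
  | eq s t => s.HasConst c ∨ t.HasConst c
  | and φ ψ => φ.HasConst c ∨ ψ.HasConst c
  | or φ ψ => φ.HasConst c ∨ ψ.HasConst c
  | imp φ ψ => φ.HasConst c ∨ ψ.HasConst c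
  | box φ => φ.HasConst c
  | dia φ => φ.HasConst c
  | all _ φ => φ.HasConst c
  | ex _ φ => φ.HasConst c
  | bot => False

/-- The variable `x` is substitutable for the constant `c`: no occurrence of `c` lies in the
scope of a quantifier that binds `x`. -/
def Substitutable (x : ℕ) (c : σ.Const) : Formula σ → Prop
  | rel _ _ => True
  | eq _ _ => True
  | and φ ψ => φ.Substitutable x c ∧ ψ.Substitutable x c
  | or φ ψ => φ.Substitutable x c ∧ ψ.Substitutable x c
  | imp φ ψ => φ.Substitutable x c ∧ ψ.Substitutable x c
  | box φ => φ.Substitutable x c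
  | dia φ => φ.Substitutable x c
  | all y φ => (y = x → ¬ φ.HasConst c) ∧ φ.Substitutable x c
  | ex y φ => (y = x → ¬ φ.HasConst c) ∧ φ.Substitutable x c
  | bot => True

/-- Neither `□` nor `◇` occurs in the formula. -/
def ModalFree : Formula σ → Prop
  | rel _ _ => True
  | eq _ _ => True
  | and φ ψ => φ.ModalFree ∧ ψ.ModalFree
  | or φ ψ => φ.ModalFree ∧ ψ.ModalFree
  | imp φ ψ => φ.ModalFree ∧ ψ.ModalFree
  | box _ => False
  | dia _ => False
  | all _ φ => φ.ModalFree
  | ex _ φ => φ.ModalFree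
  | bot => True

end Formula

/-! ## Intuitionistic propositional logic -/

inductive PropFormula : Type
  | atom (n : ℕ) : PropFormula
  | and (A B : PropFormula) : PropFormula
  | or (A B : PropFormula) : PropFormula
  | imp (A B : PropFormula) : PropFormula
  | bot : PropFormula

/-- The theorems of intuitionistic propositional logic, by the usual Hilbert system. -/
inductive IPC : PropFormula → Prop
  | k (A B : PropFormula) : IPC (.imp A (.imp B A))
  | s (A B C : PropFormula) :
      IPC (.imp (.imp A (.imp B C)) (.imp (.imp A B) (.imp A C)))
  | and_left (A B : PropFormula) : IPC (.imp (.and A B) A)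
  | and_right (A B : PropFormula) : IPC (.imp (.and A B) B)
  | and_intro (A B : PropFormula) : IPC (.imp A (.imp B (.and A B)))
  | or_left (A B : PropFormula) : IPC (.imp A (.or A B))
  | or_right (A B : PropFormula) : IPC (.imp B (.or A B))
  | or_elim (A B C : PropFormula) :
      IPC (.imp (.imp A C) (.imp (.imp B C) (.imp (.or A B) C)))
  | exfalso (A : PropFormula) : IPC (.imp .bot A)
  | mp {A B : PropFormula} : IPC (.imp A B) → IPC A → IPC B

/-- The substitution instance of a propositional formula in which the `n`-th atom is replaced
by `θ n`. -/
def PropFormula.inst (θ : ℕ → Formula σ) : PropFormula → Formula σ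
  | atom n => θ n
  | and A B => .and (A.inst θ) (B.inst θ)
  | or A B => .or (A.inst θ) (B.inst θ)
  | imp A B => .imp (A.inst θ) (B.inst θ)
  | bot => .bot

/-! ## The Hilbert system -/

open Formula in
/-- `Thm φ`: the sentence `φ` is a theorem of first-order Fischer Servi logic. -/
inductive Thm : Formula σ → Prop
  | intuit (A : PropFormula) (θ : ℕ → Formula σ) (hA : IPC A) (hθ : ∀ n, (θ n).IsSentence) :
      Thm (A.inst θ)
  | box_and (φ ψ : Formula σ) (hφ : φ.IsSentence) (hψ : ψ.IsSentence) :
      Thm (iff (box (and φ ψ)) (and (box φ) (box ψ)))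
  | box_top : Thm (box top)
  | dia_or (φ ψ : Formula σ) (hφ : φ.IsSentence) (hψ : ψ.IsSentence) :
      Thm (iff (dia (or φ ψ)) (or (dia φ) (dia ψ)))
  | dia_bot : Thm (neg (dia bot))
  | fs1 (φ ψ : Formula σ) (hφ : φ.IsSentence) (hψ : ψ.IsSentence) :
      Thm (imp (imp (dia φ) (box ψ)) (box (imp φ ψ)))
  | fs2 (φ ψ : Formula σ) (hφ : φ.IsSentence) (hψ : ψ.IsSentence) :
      Thm (imp (dia (imp φ ψ)) (imp (box φ) (dia ψ)))
  | univ (x : ℕ) (φ : Formula σ) (c : σ.Const) (hφ : φ.FreeOnlyIn x) :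
      Thm (imp (all x φ) (φ.subst x c))
  | exist (x : ℕ) (φ : Formula σ) (c : σ.Const) (hφ : φ.FreeOnlyIn x) :
      Thm (imp (φ.subst x c) (ex x φ))
  | all_ex (x : ℕ) (φ ψ : Formula σ) (hφ : φ.FreeOnlyIn x) (hψ : ψ.IsSentence) :
      Thm (imp (all x (imp φ ψ)) (imp (ex x φ) ψ))
  | all_imp (x : ℕ) (φ ψ : Formula σ) (hφ : φ.IsSentence) (hψ : ψ.FreeOnlyIn x) :
      Thm (imp (all x (imp φ ψ)) (imp φ (all x ψ)))
  | id_refl (c : σ.Const) : Thm (eq (.const c) (.const c))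
  | id_sub (x : ℕ) (φ : Formula σ) (c₁ c₂ : σ.Const) (hφ : φ.FreeOnlyIn x)
      (hm : φ.ModalFree) :
      Thm (imp (eq (.const c₁) (.const c₂)) (imp (φ.subst x c₁) (φ.subst x c₂)))
  | mp {φ ψ : Formula σ} : Thm (imp φ ψ) → Thm φ → Thm ψ
  | gen (x : ℕ) (c : σ.Const) {φ : Formula σ} (hs : φ.Substitutable x c) :
      Thm φ → Thm (all x (φ.replaceConst c x))
  | reg_box {φ ψ : Formula σ} : Thm (imp φ ψ) → Thm (imp (box φ) (box ψ))
  | reg_dia {φ ψ : Formula σ} : Thm (imp φ ψ) → Thm (imp (dia φ) (dia ψ))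

/-- `Γ ⊢ φ`: some finite conjunction of members of `Γ` provably implies `φ`. -/
def Proves (Γ : Set (Formula σ)) (φ : Formula σ) : Prop :=
  ∃ L : List (Formula σ), (∀ γ ∈ L, γ ∈ Γ) ∧ Thm (.imp (Formula.conj L) φ)

/-! ## Birelational semantics -/

/-- Fischer Servi frames. The intuitionistic relation is the partial order `≤` on worlds and
`M` is the modal relation. -/
structure FSFrame where
  World : Type u
  order : PartialOrder World
  M : World → World → Prop
  fc1 : ∀ w v v', M w v → v ≤ v' → ∃ w', w ≤ w' ∧ M w' v'
  fc2 : ∀ w w' v, w ≤ w' → M w v → ∃ v', v ≤ v' ∧ M w' v'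

attribute [instance] FSFrame.order

/-- Frames with a domain system: each world `w` carries a domain `D w` (domains expand along both
relations) and an equivalence relation `E w` on `D w` (persistent along `≤` only). -/
structure Frame extends FSFrame.{u} where
  Elem : Type u
  D : World → Set Elem
  D_le : ∀ w w', w ≤ w' → D w ⊆ D w'
  D_M : ∀ w v, M w v → D w ⊆ D v
  E : World → Elem → Elem → Prop
  E_dom : ∀ w a b, E w a b → a ∈ D w ∧ b ∈ D w
  E_refl : ∀ w, ∀ a ∈ D w, E w a a
  E_symm : ∀ w a b, E w a b → E w b a
  E_trans : ∀ w a b c, E w a b → E w b c → E w a c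
  E_le : ∀ w w' a b, w ≤ w' → E w a b → E w' a b

/-- Models: constants are interpreted rigidly, by elements of every domain; predicates are
interpreted world by world, persistently and compatibly with the relations `E w`. -/
structure Model (σ : Signature.{u}) extends Frame.{u} where
  constI : σ.Const → Elem
  constI_mem : ∀ c w, constI c ∈ D w
  predI : World → (P : σ.Pred) → Set (Fin (σ.arity P) → Elem)
  predI_dom : ∀ w P, ∀ a ∈ predI w P, ∀ i, a i ∈ D w
  predI_le : ∀ w w' P, w ≤ w' → predI w P ⊆ predI w' P
  predI_E : ∀ w P a b, (∀ i, E w (a i) (b i)) → a ∈ predI w P → b ∈ predI w P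

namespace Model

variable (𝔐 : Model.{u} σ)

/-- `g` is a `w`-variable assignment. -/
def IsVA (w : 𝔐.World) (g : ℕ → 𝔐.Elem) : Prop := ∀ x, g x ∈ 𝔐.D w

def den (g : ℕ → 𝔐.Elem) : Term σ → 𝔐.Elem
  | .const c => 𝔐.constI c
  | .var x => g x

/-- Truth of a formula at the world `w` relative to the assignment `g`. -/
def Sat (w : 𝔐.World) (g : ℕ → 𝔐.Elem) : Formula σ → Prop
  | .rel P ts => (fun i => 𝔐.den g (ts i)) ∈ 𝔐.predI w P
  | .eq s t => 𝔐.E w (𝔐.den g s) (𝔐.den g t)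
  | .and φ ψ => Sat w g φ ∧ Sat w g ψ
  | .or φ ψ => Sat w g φ ∨ Sat w g ψ
  | .imp φ ψ => ∀ w', w ≤ w' → Sat w' g φ → Sat w' g ψ
  | .box φ => ∀ w' v', w ≤ w' → 𝔐.M w' v' → Sat v' g φ
  | .dia φ => ∃ v, 𝔐.M w v ∧ Sat v g φ
  | .all x φ => ∀ w', w ≤ w' → ∀ a ∈ 𝔐.D w', Sat w' (Function.update g x a) φ
  | .ex x φ => ∃ a ∈ 𝔐.D w, Sat w (Function.update g x a) φ
  | .bot => False

/-- Truth of a sentence at a world: truth relative to each `w`-variable assignment. -/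
def Holds (w : 𝔐.World) (φ : Formula σ) : Prop := ∀ g, 𝔐.IsVA w g → 𝔐.Sat w g φ

end Model

/-- `Γ ⊩ φ`: at every world of every model where all of `Γ` is true, `φ` is true. -/
def Entails (Γ : Set (Formula σ)) (φ : Formula σ) : Prop :=
  ∀ (𝔐 : Model.{u} σ) (w : 𝔐.World), (∀ γ ∈ Γ, 𝔐.Holds w γ) → 𝔐.Holds w φ

end FOFS

/-! The proof is by contraposition: if `Γ` does not prove `φ`, a canonical model has a world whose
theory contains `Γ` and omits `φ`. Taking single prime theories as worlds fails. When `w M v ≤ v'`,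
or when a theory is enlarged to falsify an implication, the modal predecessors have to grow too, and
each of them must stay within a smaller language because domains expand along `M`. So a world here
is a whole history: a chain of prime saturated theories, consecutive members being canonically
related. The relation `M` appends one theory, and `≤` enlarges all theories of the history at once.
The condition `fc1` then holds by truncation, and the Lindenbaum construction has to treat all
places of a chain simultaneously.

The right notion of inconsistency for a chain is `Refutes`: there are interpolants `D` such that
each place, with the interpolant it receives, proves the box of the next one, and the last place
proves a forbidden sentence. Each interpolant lies in the language of the earlier of the two places.
A chain that is maximal among those without a refutation is prime, saturated and canonically linked,
because every requirement matches a transformation of refutations. Disjunctions are handled by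
conjoining interpolants before the place and disjoining them after it; boxes by adding a conjunct;
diamonds by the axiom `(◇φ → □ψ) → □(φ → ψ)`; witnesses by quantifying a fresh constant out of the
entire refutation (`IsProjection`, `Refutes.projection`).

`exists_extension` enlarges a history, possibly with one new place, and serves implication, `∀` and
`□`. `exists_M` appends a theory, and serves `◇` and `fc2`; it rests on `◇(φ → ψ) → (□φ → ◇ψ)`.

Fresh constants come from the signature itself. Its constants are split into infinitely many
infinite classes by level (the place in the history from which they are available) and stage (growth
along `≤`). The original language is renamed injectively into the class of level 0 and stage 0, and
such a renaming reflects provability. -/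

namespace FOFS

variable {σ : Signature.{u}}

/-! ## Syntax -/

namespace Term

/-- The term with every constant `c` replaced by `f c`. -/
def rename (f : σ.Const → σ.Const) : Term σ → Term σ
  | const c => const (f c)
  | var x => var x

/-- The term with each variable `x` replaced by the constant `ρ x`, if there is one. -/
def inst (ρ : ℕ → Option σ.Const) : Term σ → Term σ
  | const c => const c
  | var x => (ρ x).elim (var x) const

theorem freeVars_subst (x : ℕ) (c : σ.Const) (t : Term σ) :
    (t.subst x c).freeVars = t.freeVars.erase x := by
  cases t with
  | const d => simp [subst, freeVars]
  | var y =>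
    by_cases h : y = x
    · simp [subst, freeVars, h]
    · simp [subst, freeVars, h, Finset.erase_eq_of_notMem, Ne.symm h]

theorem freeVars_replaceConst (x : ℕ) (c : σ.Const) (t : Term σ) :
    (t.replaceConst c x).freeVars ⊆ insert x t.freeVars := by
  cases t with
  | const d => by_cases h : d = c <;> simp [replaceConst, freeVars, h]
  | var y => simp [replaceConst, freeVars]

theorem HasConst.of_subst {x : ℕ} {c d : σ.Const} {t : Term σ} (h : (t.subst x c).HasConst d) :
    t.HasConst d ∨ d = c := by
  cases t with
  | const e => exact Or.inl h
  | var y =>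
    by_cases hy : y = x
    · simp only [subst, hy, if_true, HasConst] at h; exact Or.inr h.symm
    · simp [subst, hy, HasConst] at h

theorem HasConst.of_replaceConst {x : ℕ} {c d : σ.Const} {t : Term σ}
    (h : (t.replaceConst c x).HasConst d) : t.HasConst d ∧ d ≠ c := by
  cases t with
  | const e =>
    by_cases he : e = c
    · simp [replaceConst, HasConst, he] at h
    · simp only [replaceConst, HasConst, he, if_false] at h ⊢
      exact ⟨h, h ▸ he⟩
  | var y => simp [replaceConst, HasConst] at h

theorem replaceConst_of_not_hasConst {x : ℕ} {c : σ.Const} {t : Term σ} (h : ¬ t.HasConst c) :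
    t.replaceConst c x = t := by
  cases t with
  | const e => simp only [HasConst] at h; simp [replaceConst, h]
  | var y => rfl

theorem replaceConst_subst {x : ℕ} {c : σ.Const} {t : Term σ} (h : ¬ t.HasConst c) :
    (t.subst x c).replaceConst c x = t := by
  cases t with
  | const e => simp only [HasConst] at h; simp [subst, replaceConst, h]
  | var y => by_cases hy : y = x <;> simp [subst, replaceConst, hy]

theorem subst_replaceConst {x : ℕ} {c : σ.Const} {t : Term σ} (h : x ∉ t.freeVars) :
    (t.replaceConst c x).subst x c = t := by
  cases t with
  | const e => by_cases he : e = c <;> simp [subst, replaceConst, he]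
  | var y =>
    have : y ≠ x := by simpa [freeVars, eq_comm] using h
    simp [subst, replaceConst, this]

theorem finite_hasConst (t : Term σ) : {c | t.HasConst c}.Finite := by
  cases t with
  | const d =>
    exact (Set.finite_singleton d).subset fun c hc => by simpa [HasConst, eq_comm] using hc
  | var y => simp [HasConst]

theorem rename_subst (f : σ.Const → σ.Const) (x : ℕ) (c : σ.Const) (t : Term σ) :
    (t.subst x c).rename f = (t.rename f).subst x (f c) := by
  cases t with
  | const d => rfl
  | var y => by_cases hy : y = x <;> simp [subst, rename, hy]

theorem freeVars_rename (f : σ.Const → σ.Const) (t : Term σ) :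
    (t.rename f).freeVars = t.freeVars := by
  cases t <;> rfl

theorem hasConst_rename {f : σ.Const → σ.Const} {d : σ.Const} {t : Term σ} :
    (t.rename f).HasConst d ↔ ∃ c, t.HasConst c ∧ f c = d := by
  cases t <;> simp [rename, HasConst]

theorem rename_rename (f g : σ.Const → σ.Const) (t : Term σ) :
    (t.rename f).rename g = t.rename (g ∘ f) := by
  cases t <;> rfl

theorem rename_id (t : Term σ) : t.rename id = t := by
  cases t <;> rfl

theorem replaceConst_rename_update [DecidableEq σ.Const] {f : σ.Const → σ.Const} {x : ℕ}
    {c c' : σ.Const} {t : Term σ} (h : ∀ d, t.HasConst d → d ≠ c → f d ≠ c') :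
    (t.rename (Function.update f c c')).replaceConst c' x = (t.replaceConst c x).rename f := by
  cases t with
  | const d =>
    by_cases hd : d = c
    · simp [replaceConst, rename, hd]
    · simp [replaceConst, rename, hd, h d rfl hd]
  | var y => rfl

theorem inst_subst [DecidableEq σ.Const] (ρ : ℕ → Option σ.Const) (x : ℕ) (c : σ.Const)
    (t : Term σ) :
    (t.inst (Function.update ρ x none)).subst x c = t.inst (Function.update ρ x (some c)) := by
  cases t with
  | const d => rfl
  | var y =>
    by_cases hy : y = x
    · subst hy; simp [inst, subst]
    · cases hρ : ρ y <;> simp [inst, subst, hy, hρ]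

theorem mem_freeVars_inst {ρ : ℕ → Option σ.Const} {y : ℕ} {t : Term σ} :
    y ∈ (t.inst ρ).freeVars ↔ y ∈ t.freeVars ∧ ρ y = none := by
  cases t with
  | const d => simp [inst, freeVars]
  | var z =>
    cases hρ : ρ z with
    | none =>
      simp only [inst, freeVars, hρ, Option.elim, Finset.mem_singleton]
      exact ⟨fun h => ⟨h, h ▸ hρ⟩, And.left⟩
    | some c =>
      simp only [inst, freeVars, hρ, Option.elim, Finset.mem_singleton, Finset.notMem_empty,
        false_iff, not_and]
      rintro rfl
      simp [hρ]

theorem HasConst.of_inst {ρ : ℕ → Option σ.Const} {c : σ.Const} {t : Term σ}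
    (h : (t.inst ρ).HasConst c) : t.HasConst c ∨ ∃ x, ρ x = some c := by
  cases t with
  | const d => exact Or.inl h
  | var z =>
    cases hρ : ρ z with
    | none => simp [inst, hρ, HasConst] at h
    | some d =>
      simp only [inst, hρ, Option.elim, HasConst] at h
      exact Or.inr ⟨z, by rw [hρ, h]⟩

theorem inst_eq_self {ρ : ℕ → Option σ.Const} {t : Term σ} (h : ∀ x ∈ t.freeVars, ρ x = none) :
    t.inst ρ = t := by
  cases t with
  | const d => rfl
  | var z => simp [inst, h z (by simp [freeVars])]

end Term

namespace Formula

/-- The formula with every constant `c` replaced by `f c`. -/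
def rename (f : σ.Const → σ.Const) : Formula σ → Formula σ
  | rel P ts => rel P fun i => (ts i).rename f
  | eq s t => eq (s.rename f) (t.rename f)
  | and φ ψ => and (φ.rename f) (ψ.rename f)
  | or φ ψ => or (φ.rename f) (ψ.rename f)
  | imp φ ψ => imp (φ.rename f) (ψ.rename f)
  | box φ => box (φ.rename f)
  | dia φ => dia (φ.rename f)
  | all y φ => all y (φ.rename f)
  | ex y φ => ex y (φ.rename f)
  | bot => bot

/-- The formula with each free variable `x` replaced by the constant `ρ x`, if there is one. -/
def inst (ρ : ℕ → Option σ.Const) : Formula σ → Formula σ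
  | rel P ts => rel P fun i => (ts i).inst ρ
  | eq s t => eq (s.inst ρ) (t.inst ρ)
  | and φ ψ => and (φ.inst ρ) (ψ.inst ρ)
  | or φ ψ => or (φ.inst ρ) (ψ.inst ρ)
  | imp φ ψ => imp (φ.inst ρ) (ψ.inst ρ)
  | box φ => box (φ.inst ρ)
  | dia φ => dia (φ.inst ρ)
  | all y φ => all y (φ.inst (Function.update ρ y none))
  | ex y φ => ex y (φ.inst (Function.update ρ y none))
  | bot => bot

/-- All variables of the formula, free or bound. -/
def vars : Formula σ → Finset ℕ
  | rel _ ts => Finset.univ.biUnion fun i => (ts i).freeVars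
  | eq s t => s.freeVars ∪ t.freeVars
  | and φ ψ => φ.vars ∪ ψ.vars
  | or φ ψ => φ.vars ∪ ψ.vars
  | imp φ ψ => φ.vars ∪ ψ.vars
  | box φ => φ.vars
  | dia φ => φ.vars
  | all x φ => insert x φ.vars
  | ex x φ => insert x φ.vars
  | bot => ∅

theorem freeVars_subst (x : ℕ) (c : σ.Const) (φ : Formula σ) :
    (φ.subst x c).freeVars = φ.freeVars.erase x := by
  induction φ with
  | rel P ts => ext y; simp [subst, freeVars, Term.freeVars_subst]
  | eq s t => simp [subst, freeVars, Term.freeVars_subst, Finset.erase_union_distrib]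
  | and φ ψ h1 h2 | or φ ψ h1 h2 | imp φ ψ h1 h2 =>
    simp [subst, freeVars, h1, h2, Finset.erase_union_distrib]
  | box φ h | dia φ h => simpa [subst, freeVars] using h
  | all y φ h | ex y φ h =>
    by_cases hy : y = x
    · simp [subst, freeVars, hy]
    · simp [subst, freeVars, hy, h, Finset.erase_right_comm]
  | bot => simp [subst, freeVars]

theorem freeVars_replaceConst (x : ℕ) (c : σ.Const) (φ : Formula σ) :
    (φ.replaceConst c x).freeVars ⊆ insert x φ.freeVars := by
  induction φ with
  | rel P ts =>
    simp only [replaceConst, freeVars, Finset.biUnion_subset]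
    intro i _ y hy
    have := Term.freeVars_replaceConst x c (ts i) hy
    simp only [Finset.mem_insert, Finset.mem_biUnion, Finset.mem_univ, true_and] at this ⊢
    exact this.imp_right fun h => ⟨i, h⟩
  | eq s t =>
    have h1 := Term.freeVars_replaceConst x c s
    have h2 := Term.freeVars_replaceConst x c t
    simp only [replaceConst, freeVars]
    grind
  | and φ ψ h1 h2 | or φ ψ h1 h2 | imp φ ψ h1 h2 =>
    simp only [replaceConst, freeVars]
    grind
  | box φ h | dia φ h => simpa [replaceConst, freeVars] using h
  | all y φ h | ex y φ h =>
    simp only [replaceConst, freeVars]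
    grind
  | bot => simp [replaceConst, freeVars]

theorem HasConst.of_subst {x : ℕ} {c d : σ.Const} {φ : Formula σ}
    (h : (φ.subst x c).HasConst d) : φ.HasConst d ∨ d = c := by
  induction φ with
  | rel P ts =>
    obtain ⟨i, hi⟩ := h
    exact hi.of_subst.imp_left fun h => ⟨i, h⟩
  | eq s t =>
    rcases h with h | h
    · exact h.of_subst.imp_left Or.inl
    · exact h.of_subst.imp_left Or.inr
  | and φ ψ h1 h2 | or φ ψ h1 h2 | imp φ ψ h1 h2 =>
    rcases h with h | h
    · exact (h1 h).imp_left Or.inl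
    · exact (h2 h).imp_left Or.inr
  | box φ ih | dia φ ih => exact ih h
  | all y φ ih | ex y φ ih =>
    by_cases hy : y = x
    · simp only [subst, hy, if_true] at h; exact Or.inl h
    · simp only [subst, hy, if_false] at h; exact ih h
  | bot => exact h.elim

theorem HasConst.of_replaceConst {x : ℕ} {c d : σ.Const} {φ : Formula σ}
    (h : (φ.replaceConst c x).HasConst d) : φ.HasConst d ∧ d ≠ c := by
  induction φ with
  | rel P ts =>
    obtain ⟨i, hi⟩ := h
    exact ⟨⟨i, hi.of_replaceConst.1⟩, hi.of_replaceConst.2⟩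
  | eq s t =>
    rcases h with h | h
    · exact h.of_replaceConst.imp_left Or.inl
    · exact h.of_replaceConst.imp_left Or.inr
  | and φ ψ h1 h2 | or φ ψ h1 h2 | imp φ ψ h1 h2 =>
    rcases h with h | h
    · exact (h1 h).imp_left Or.inl
    · exact (h2 h).imp_left Or.inr
  | box φ ih | dia φ ih | all y φ ih | ex y φ ih => exact ih h
  | bot => exact h.elim

theorem replaceConst_of_not_hasConst {x : ℕ} {c : σ.Const} {φ : Formula σ}
    (h : ¬ φ.HasConst c) : φ.replaceConst c x = φ := by
  induction φ with
  | rel P ts =>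
    simp only [HasConst, not_exists] at h
    simp [replaceConst, Term.replaceConst_of_not_hasConst (h _)]
  | eq s t =>
    simp only [HasConst, not_or] at h
    simp [replaceConst, Term.replaceConst_of_not_hasConst h.1,
      Term.replaceConst_of_not_hasConst h.2]
  | and φ ψ h1 h2 | or φ ψ h1 h2 | imp φ ψ h1 h2 =>
    simp only [HasConst, not_or] at h
    simp [replaceConst, h1 h.1, h2 h.2]
  | box φ ih | dia φ ih | all y φ ih | ex y φ ih =>
    simp only [replaceConst, ih h]
  | bot => rfl

theorem replaceConst_subst {x : ℕ} {c : σ.Const} {φ : Formula σ} (h : ¬ φ.HasConst c) :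
    (φ.subst x c).replaceConst c x = φ := by
  induction φ with
  | rel P ts =>
    simp only [HasConst, not_exists] at h
    simp [subst, replaceConst, Term.replaceConst_subst (h _)]
  | eq s t =>
    simp only [HasConst, not_or] at h
    simp [subst, replaceConst, Term.replaceConst_subst h.1, Term.replaceConst_subst h.2]
  | and φ ψ h1 h2 | or φ ψ h1 h2 | imp φ ψ h1 h2 =>
    simp only [HasConst, not_or] at h
    simp [subst, replaceConst, h1 h.1, h2 h.2]
  | box φ ih | dia φ ih => simp only [subst, replaceConst, ih h]
  | all y φ ih | ex y φ ih =>
    by_cases hy : y = x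
    · simp only [subst, hy, if_true]
      exact replaceConst_of_not_hasConst h
    · simp only [subst, hy, if_false, replaceConst, ih h]
  | bot => rfl

theorem substitutable_of_not_hasConst {x : ℕ} {c : σ.Const} {φ : Formula σ}
    (h : ¬ φ.HasConst c) : φ.Substitutable x c := by
  induction φ with
  | rel P ts | eq s t | bot => trivial
  | and φ ψ h1 h2 | or φ ψ h1 h2 | imp φ ψ h1 h2 =>
    simp only [HasConst, not_or] at h
    exact ⟨h1 h.1, h2 h.2⟩
  | box φ ih | dia φ ih => exact ih h
  | all y φ ih | ex y φ ih => exact ⟨fun _ => h, ih h⟩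

theorem substitutable_subst {x : ℕ} {c : σ.Const} {φ : Formula σ} (h : ¬ φ.HasConst c) :
    (φ.subst x c).Substitutable x c := by
  induction φ with
  | rel P ts | eq s t | bot => trivial
  | and φ ψ h1 h2 | or φ ψ h1 h2 | imp φ ψ h1 h2 =>
    simp only [HasConst, not_or] at h
    exact ⟨h1 h.1, h2 h.2⟩
  | box φ ih | dia φ ih => exact ih h
  | all y φ ih | ex y φ ih =>
    by_cases hy : y = x
    · simp only [subst, hy, if_true]
      exact substitutable_of_not_hasConst h
    · simp only [subst, hy, if_false]
      exact ⟨fun h' => (hy h').elim, ih h⟩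

theorem subst_replaceConst {x : ℕ} {c : σ.Const} {φ : Formula σ} (h : x ∉ φ.vars) :
    (φ.replaceConst c x).subst x c = φ := by
  induction φ with
  | rel P ts =>
    have h' : ∀ i, x ∉ (ts i).freeVars := by simpa [vars] using h
    simp [subst, replaceConst, Term.subst_replaceConst (h' _)]
  | eq s t =>
    simp only [vars, Finset.mem_union, not_or] at h
    simp [subst, replaceConst, Term.subst_replaceConst h.1, Term.subst_replaceConst h.2]
  | and φ ψ h1 h2 | or φ ψ h1 h2 | imp φ ψ h1 h2 =>
    simp only [vars, Finset.mem_union, not_or] at h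
    simp [subst, replaceConst, h1 h.1, h2 h.2]
  | box φ ih | dia φ ih => simp only [subst, replaceConst, ih h]
  | all y φ ih | ex y φ ih =>
    simp only [vars, Finset.mem_insert, not_or] at h
    simp [subst, replaceConst, ih h.2, Ne.symm h.1]
  | bot => rfl

theorem finite_hasConst (φ : Formula σ) : {c | φ.HasConst c}.Finite := by
  induction φ with
  | rel P ts =>
    exact (Set.finite_iUnion fun i => (ts i).finite_hasConst).subset fun c hc => by
      simpa [HasConst] using hc
  | eq s t => exact s.finite_hasConst.union t.finite_hasConst
  | and φ ψ h1 h2 | or φ ψ h1 h2 | imp φ ψ h1 h2 => exact h1.union h2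
  | box φ ih | dia φ ih | all y φ ih | ex y φ ih => exact ih
  | bot => simp [HasConst]

theorem rename_subst (f : σ.Const → σ.Const) (x : ℕ) (c : σ.Const) (φ : Formula σ) :
    (φ.subst x c).rename f = (φ.rename f).subst x (f c) := by
  induction φ with
  | rel P ts => simp [subst, rename, Term.rename_subst]
  | eq s t => simp [subst, rename, Term.rename_subst]
  | and φ ψ h1 h2 | or φ ψ h1 h2 | imp φ ψ h1 h2 => simp [subst, rename, h1, h2]
  | box φ ih | dia φ ih => simp [subst, rename, ih]
  | all y φ ih | ex y φ ih => by_cases hy : y = x <;> simp [subst, rename, hy, ih]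
  | bot => rfl

theorem freeVars_rename (f : σ.Const → σ.Const) (φ : Formula σ) :
    (φ.rename f).freeVars = φ.freeVars := by
  induction φ <;> simp_all [rename, freeVars, Term.freeVars_rename]

theorem ModalFree.rename {f : σ.Const → σ.Const} {φ : Formula σ} (h : φ.ModalFree) :
    (φ.rename f).ModalFree := by
  induction φ <;> simp_all [Formula.rename, ModalFree]

theorem hasConst_rename {f : σ.Const → σ.Const} {d : σ.Const} {φ : Formula σ} :
    (φ.rename f).HasConst d ↔ ∃ c, φ.HasConst c ∧ f c = d := by
  induction φ with
  | rel P ts =>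
    simp only [rename, HasConst, Term.hasConst_rename]
    exact ⟨fun ⟨i, c, h, e⟩ => ⟨c, ⟨i, h⟩, e⟩, fun ⟨c, ⟨i, h⟩, e⟩ => ⟨i, c, h, e⟩⟩
  | eq s t => simp only [rename, HasConst, Term.hasConst_rename, or_and_right, exists_or]
  | and φ ψ h1 h2 | or φ ψ h1 h2 | imp φ ψ h1 h2 =>
    simp only [rename, HasConst, h1, h2, or_and_right, exists_or]
  | box φ ih | dia φ ih | all y φ ih | ex y φ ih => simpa only [rename, HasConst] using ih
  | bot => simp [rename, HasConst]

theorem rename_rename (f g : σ.Const → σ.Const) (φ : Formula σ) :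
    (φ.rename f).rename g = φ.rename (g ∘ f) := by
  induction φ <;> simp_all [rename, Term.rename_rename]

theorem rename_id (φ : Formula σ) : φ.rename id = φ := by
  induction φ <;> simp_all [rename, Term.rename_id]

/-- A renaming may merge other constants with `c`, which would spoil a generalisation on `c`.
Sending `c` to a value `c'` not shared with any other constant of `φ` avoids this. -/
theorem replaceConst_rename_update [DecidableEq σ.Const] {f : σ.Const → σ.Const} {x : ℕ}
    {c c' : σ.Const} {φ : Formula σ} (h : ∀ d, φ.HasConst d → d ≠ c → f d ≠ c') :
    (φ.rename (Function.update f c c')).replaceConst c' x = (φ.replaceConst c x).rename f := by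
  induction φ with
  | rel P ts =>
    simp only [rename, replaceConst]
    congr 1
    funext i
    exact Term.replaceConst_rename_update fun c hc => h c ⟨i, hc⟩
  | eq s t =>
    simp only [rename, replaceConst]
    rw [Term.replaceConst_rename_update fun c hc => h c (Or.inl hc),
      Term.replaceConst_rename_update fun c hc => h c (Or.inr hc)]
  | and φ ψ h1 h2 | or φ ψ h1 h2 | imp φ ψ h1 h2 =>
    simp only [rename, replaceConst]
    rw [h1 fun c hc => h c (Or.inl hc), h2 fun c hc => h c (Or.inr hc)]
  | box φ ih | dia φ ih | all y φ ih | ex y φ ih =>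
    simp only [rename, replaceConst]
    rw [ih h]
  | bot => rfl

theorem Substitutable.rename_update [DecidableEq σ.Const] {f : σ.Const → σ.Const} {x : ℕ}
    {c c' : σ.Const} {φ : Formula σ} (h : ∀ d, φ.HasConst d → d ≠ c → f d ≠ c')
    (hs : φ.Substitutable x c) : (φ.rename (Function.update f c c')).Substitutable x c' := by
  have key : ∀ ψ : Formula σ, (∀ d, ψ.HasConst d → d ≠ c → f d ≠ c') → ¬ ψ.HasConst c →
      ¬ (ψ.rename (Function.update f c c')).HasConst c' := by
    intro ψ hψ hc hc'
    obtain ⟨d, hd, e⟩ := hasConst_rename.1 hc'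
    have hdc : d ≠ c := fun h => hc (h ▸ hd)
    rw [Function.update_of_ne hdc] at e
    exact hψ d hd hdc e
  induction φ with
  | rel P ts | eq s t | bot => trivial
  | and φ ψ h1 h2 | or φ ψ h1 h2 | imp φ ψ h1 h2 =>
    exact ⟨h1 (fun d hd => h d (Or.inl hd)) hs.1, h2 (fun d hd => h d (Or.inr hd)) hs.2⟩
  | box φ ih | dia φ ih => exact ih h hs
  | all y φ ih | ex y φ ih => exact ⟨fun hy => key φ h (hs.1 hy), ih h hs.2⟩

/-- Constants cannot be captured, so no side condition is needed. In the truth lemma this links an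
instance of a quantified formula with an updated assignment. -/
theorem inst_subst (ρ : ℕ → Option σ.Const) (x : ℕ) (c : σ.Const) (φ : Formula σ) :
    (φ.inst (Function.update ρ x none)).subst x c = φ.inst (Function.update ρ x (some c)) := by
  classical
  induction φ generalizing ρ with
  | rel P ts => simp [subst, inst, Term.inst_subst]
  | eq s t => simp [subst, inst, Term.inst_subst]
  | and φ ψ h1 h2 | or φ ψ h1 h2 | imp φ ψ h1 h2 => simp [subst, inst, h1, h2]
  | box φ ih | dia φ ih => simp [subst, inst, ih]
  | all y φ ih | ex y φ ih =>
    by_cases hy : y = x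
    · simp [subst, inst, hy]
    · simp only [subst, inst, hy, if_false]
      rw [Function.update_comm (Ne.symm hy), ih, Function.update_comm hy]
  | bot => rfl

theorem mem_freeVars_inst {ρ : ℕ → Option σ.Const} {y : ℕ} {φ : Formula σ} :
    y ∈ (φ.inst ρ).freeVars ↔ y ∈ φ.freeVars ∧ ρ y = none := by
  induction φ generalizing ρ with
  | rel P ts => simp [inst, freeVars, Term.mem_freeVars_inst]
  | eq s t => simp only [inst, freeVars, Term.mem_freeVars_inst, Finset.mem_union, or_and_right]
  | and φ ψ h1 h2 | or φ ψ h1 h2 | imp φ ψ h1 h2 =>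
    simp only [inst, freeVars, h1, h2, Finset.mem_union, or_and_right]
  | box φ ih | dia φ ih => simpa only [inst, freeVars] using ih
  | all z φ ih | ex z φ ih =>
    simp only [inst, freeVars, ih, Finset.mem_erase]
    by_cases hy : y = z <;> simp [hy]
  | bot => simp [inst, freeVars]

theorem HasConst.of_inst {ρ : ℕ → Option σ.Const} {c : σ.Const} {φ : Formula σ}
    (h : (φ.inst ρ).HasConst c) : φ.HasConst c ∨ ∃ x, ρ x = some c := by
  induction φ generalizing ρ with
  | rel P ts =>
    obtain ⟨i, hi⟩ := h
    exact hi.of_inst.imp_left fun h => ⟨i, h⟩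
  | eq s t =>
    rcases h with h | h
    · exact h.of_inst.imp_left Or.inl
    · exact h.of_inst.imp_left Or.inr
  | and φ ψ h1 h2 | or φ ψ h1 h2 | imp φ ψ h1 h2 =>
    rcases h with h | h
    · exact (h1 h).imp_left Or.inl
    · exact (h2 h).imp_left Or.inr
  | box φ ih | dia φ ih => exact ih h
  | all y φ ih | ex y φ ih =>
    refine (ih h).imp_right ?_
    rintro ⟨x, hx⟩
    by_cases hy : x = y
    · simp [hy] at hx
    · exact ⟨x, by simpa [hy] using hx⟩
  | bot => exact h.elim

theorem inst_eq_self {ρ : ℕ → Option σ.Const} {φ : Formula σ}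
    (h : ∀ x ∈ φ.freeVars, ρ x = none) : φ.inst ρ = φ := by
  induction φ generalizing ρ with
  | rel P ts =>
    simp only [inst]
    congr 1
    funext i
    exact Term.inst_eq_self fun x hx => h x (by simpa [freeVars] using ⟨i, hx⟩)
  | eq s t =>
    simp only [inst]
    rw [Term.inst_eq_self fun x hx => h x (Finset.mem_union_left _ hx),
      Term.inst_eq_self fun x hx => h x (Finset.mem_union_right _ hx)]
  | and φ ψ h1 h2 | or φ ψ h1 h2 | imp φ ψ h1 h2 =>
    simp only [inst]
    rw [h1 fun x hx => h x (Finset.mem_union_left _ hx),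
      h2 fun x hx => h x (Finset.mem_union_right _ hx)]
  | box φ ih | dia φ ih =>
    simp only [inst]
    rw [ih h]
  | all y φ ih | ex y φ ih =>
    simp only [inst]
    rw [ih fun x hx => ?_]
    by_cases hy : x = y
    · simp [hy]
    · simpa [hy] using h x (Finset.mem_erase.2 ⟨hy, hx⟩)
  | bot => rfl

/-- Needed to enumerate formulas in the Lindenbaum construction. The code of a formula pairs a tag
for its head symbol with the codes of its parts. -/
instance countable_formula : Countable (Formula σ) := by
  have := σ.countable_const
  have := σ.countable_pred
  obtain ⟨fc, hfc⟩ := exists_injective_nat σ.Const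
  have ht : ∃ ft : Term σ → ℕ, Function.Injective ft := by
    refine ⟨fun t => match t with
      | .const c => 2 * fc c
      | .var x => 2 * x + 1, ?_⟩
    intro s t h
    cases s <;> cases t <;> simp only at h
    · exact congrArg _ (hfc (by omega))
    · omega
    · omega
    · exact congrArg _ (by omega)
  obtain ⟨ft, hft⟩ := ht
  have hTerm : Countable (Term σ) := hft.countable
  obtain ⟨fa, hfa⟩ := exists_injective_nat ((P : σ.Pred) × (Fin (σ.arity P) → Term σ))
  let code : Formula σ → ℕ := fun φ => Formula.rec (motive := fun _ => ℕ)
    (fun P ts => Nat.pair 0 (fa ⟨P, ts⟩))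
    (fun s t => Nat.pair 1 (Nat.pair (ft s) (ft t)))
    (fun _ _ a b => Nat.pair 2 (Nat.pair a b))
    (fun _ _ a b => Nat.pair 3 (Nat.pair a b))
    (fun _ _ a b => Nat.pair 4 (Nat.pair a b))
    (fun _ a => Nat.pair 5 a)
    (fun _ a => Nat.pair 6 a)
    (fun x _ a => Nat.pair 7 (Nat.pair x a))
    (fun x _ a => Nat.pair 8 (Nat.pair x a))
    (Nat.pair 9 0) φ
  have hcode : Function.Injective code := by
    intro φ
    induction φ with
    | rel P ts =>
      intro ψ h
      cases ψ <;> simp only [code, Nat.pair_eq_pair] at h <;> try omega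
      have := hfa h.2
      simp only [Sigma.mk.injEq] at this
      obtain ⟨rfl, h'⟩ := this
      rw [eq_of_heq h']
    | eq s t =>
      intro ψ h
      cases ψ <;> simp only [code, Nat.pair_eq_pair] at h <;> try omega
      rw [hft h.2.1, hft h.2.2]
    | and φ ψ h1 h2 | or φ ψ h1 h2 | imp φ ψ h1 h2 =>
      intro ψ h
      cases ψ <;> simp only [code, Nat.pair_eq_pair] at h <;> try omega
      rw [h1 h.2.1, h2 h.2.2]
    | box φ ih | dia φ ih =>
      intro ψ h
      cases ψ <;> simp only [code, Nat.pair_eq_pair] at h <;> try omega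
      rw [ih h.2]
    | all y φ ih | ex y φ ih =>
      intro ψ h
      cases ψ <;> simp only [code, Nat.pair_eq_pair] at h <;> try omega
      rw [h.2.1, ih h.2.2]
    | bot =>
      intro ψ h
      cases ψ <;> simp only [code, Nat.pair_eq_pair] at h <;> first | omega | rfl
  exact hcode.countable

theorem subst_eq_self {x : ℕ} {c : σ.Const} {φ : Formula σ} (h : x ∉ φ.freeVars) : φ.subst x c = φ := by
  have ht : ∀ t : Term σ, x ∉ t.freeVars → t.subst x c = t := by
    intro t h
    cases t with
    | const d => rfl
    | var y =>
      have : y ≠ x := by simpa [Term.freeVars, eq_comm] using h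
      simp [Term.subst, this]
  induction φ with
  | rel P ts =>
    have h' : ∀ i, x ∉ (ts i).freeVars := by simpa [freeVars] using h
    simp [subst, ht _ (h' _)]
  | eq s t =>
    simp only [freeVars, Finset.mem_union, not_or] at h
    simp [subst, ht _ h.1, ht _ h.2]
  | and φ ψ h1 h2 | or φ ψ h1 h2 | imp φ ψ h1 h2 =>
    simp only [freeVars, Finset.mem_union, not_or] at h
    simp [subst, h1 h.1, h2 h.2]
  | box φ ih | dia φ ih => simp only [subst, ih h]
  | all y φ ih | ex y φ ih =>
    by_cases hy : y = x
    · simp [subst, hy]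
    · simp only [freeVars, Finset.mem_erase, not_and] at h
      simp [subst, hy, ih (h (Ne.symm hy))]
  | bot => rfl

theorem IsSentence.subst_eq {x : ℕ} {c : σ.Const} {φ : Formula σ} (h : φ.IsSentence) :
    φ.subst x c = φ :=
  subst_eq_self (by rw [IsSentence] at h; simp [h])

/-- The sentences all of whose constants lie in `S`. -/
def sentences (S : Set σ.Const) : Set (Formula σ) :=
  {φ | φ.IsSentence ∧ ∀ c, φ.HasConst c → c ∈ S}

section

variable {S T : Set σ.Const} {φ ψ : Formula σ}

theorem isSentence_and : (and φ ψ).IsSentence ↔ φ.IsSentence ∧ ψ.IsSentence := by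
  simp [IsSentence, freeVars, Finset.union_eq_empty]

theorem isSentence_or : (or φ ψ).IsSentence ↔ φ.IsSentence ∧ ψ.IsSentence := by
  simp [IsSentence, freeVars, Finset.union_eq_empty]

theorem isSentence_imp : (imp φ ψ).IsSentence ↔ φ.IsSentence ∧ ψ.IsSentence := by
  simp [IsSentence, freeVars, Finset.union_eq_empty]

theorem isSentence_top : (top : Formula σ).IsSentence := rfl

theorem isSentence_all {x : ℕ} : (all x φ).IsSentence ↔ φ.FreeOnlyIn x := by
  simp [IsSentence, FreeOnlyIn, freeVars, Finset.erase_eq_empty_iff, Finset.subset_singleton_iff]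

theorem isSentence_ex {x : ℕ} : (ex x φ).IsSentence ↔ φ.FreeOnlyIn x := isSentence_all

theorem FreeOnlyIn.isSentence_subst {x : ℕ} {c : σ.Const} (h : φ.FreeOnlyIn x) :
    (φ.subst x c).IsSentence := by
  rw [IsSentence, freeVars_subst]
  exact isSentence_all.2 h

theorem sentences_mono (h : S ⊆ T) : sentences S ⊆ sentences T :=
  fun _ hφ => ⟨hφ.1, fun c hc => h (hφ.2 c hc)⟩

theorem and_mem_sentences : and φ ψ ∈ sentences S ↔ φ ∈ sentences S ∧ ψ ∈ sentences S := by
  simp only [sentences, Set.mem_ofPred_eq, isSentence_and, HasConst, or_imp, forall_and]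
  tauto

theorem or_mem_sentences : or φ ψ ∈ sentences S ↔ φ ∈ sentences S ∧ ψ ∈ sentences S :=
  and_mem_sentences

theorem imp_mem_sentences : imp φ ψ ∈ sentences S ↔ φ ∈ sentences S ∧ ψ ∈ sentences S :=
  and_mem_sentences

theorem box_mem_sentences : box φ ∈ sentences S ↔ φ ∈ sentences S := Iff.rfl

theorem dia_mem_sentences : dia φ ∈ sentences S ↔ φ ∈ sentences S := Iff.rfl

theorem bot_mem_sentences : bot ∈ sentences S := ⟨rfl, fun _ h => h.elim⟩

theorem top_mem_sentences : top ∈ sentences S := imp_mem_sentences.2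
  ⟨bot_mem_sentences, bot_mem_sentences⟩

theorem subst_mem_sentences {x : ℕ} {c : σ.Const} (h : all x φ ∈ sentences S) (hc : c ∈ S) :
    φ.subst x c ∈ sentences S :=
  ⟨(isSentence_all.1 h.1).isSentence_subst, fun d hd => hd.of_subst.elim (h.2 d) fun e => e ▸ hc⟩

end

end Formula

open Formula

/-! ## The calculus -/

namespace Thm

variable {φ ψ χ : Formula σ}

theorem isSentence (h : Thm φ) : φ.IsSentence := by
  induction h with
  | intuit A θ hA hθ =>
    clear hA
    induction A with
    | atom n => exact hθ n
    | and A B h1 h2 => exact isSentence_and.2 ⟨h1, h2⟩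
    | or A B h1 h2 => exact isSentence_or.2 ⟨h1, h2⟩
    | imp A B h1 h2 => exact isSentence_imp.2 ⟨h1, h2⟩
    | bot => rfl
  | box_and φ ψ h1 h2 =>
    have h3 : (box (φ.and ψ)).IsSentence := isSentence_and.2 ⟨h1, h2⟩
    have h4 : ((box φ).and (box ψ)).IsSentence := isSentence_and.2 ⟨h1, h2⟩
    exact isSentence_and.2 ⟨isSentence_imp.2 ⟨h3, h4⟩, isSentence_imp.2 ⟨h4, h3⟩⟩
  | box_top => rfl
  | dia_or φ ψ h1 h2 =>
    have h3 : (dia (φ.or ψ)).IsSentence := isSentence_or.2 ⟨h1, h2⟩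
    have h4 : ((dia φ).or (dia ψ)).IsSentence := isSentence_or.2 ⟨h1, h2⟩
    exact isSentence_and.2 ⟨isSentence_imp.2 ⟨h3, h4⟩, isSentence_imp.2 ⟨h4, h3⟩⟩
  | dia_bot => rfl
  | fs1 φ ψ h1 h2 =>
    have h3 : ((dia φ).imp (box ψ)).IsSentence := isSentence_imp.2 ⟨h1, h2⟩
    exact isSentence_imp.2 ⟨h3, isSentence_imp.2 ⟨h1, h2⟩⟩
  | fs2 φ ψ h1 h2 =>
    have h3 : ((box φ).imp (dia ψ)).IsSentence := isSentence_imp.2 ⟨h1, h2⟩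
    exact isSentence_imp.2 ⟨isSentence_imp.2 ⟨h1, h2⟩, h3⟩
  | univ x φ c h => exact isSentence_imp.2 ⟨isSentence_all.2 h, h.isSentence_subst⟩
  | exist x φ c h => exact isSentence_imp.2 ⟨h.isSentence_subst, isSentence_ex.2 h⟩
  | all_ex x φ ψ h1 h2 =>
    refine isSentence_imp.2 ⟨isSentence_all.2 ?_, isSentence_imp.2 ⟨isSentence_ex.2 h1, h2⟩⟩
    rw [IsSentence] at h2
    simpa [FreeOnlyIn, freeVars, h2] using h1
  | all_imp x φ ψ h1 h2 =>
    refine isSentence_imp.2 ⟨isSentence_all.2 ?_, isSentence_imp.2 ⟨h1, isSentence_all.2 h2⟩⟩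
    rw [IsSentence] at h1
    simpa [FreeOnlyIn, freeVars, h1] using h2
  | id_refl c => rfl
  | id_sub x φ c₁ c₂ h hm =>
    exact isSentence_imp.2 ⟨rfl, isSentence_imp.2 ⟨h.isSentence_subst, h.isSentence_subst⟩⟩
  | mp _ _ h1 h2 => exact (isSentence_imp.1 h1).2
  | gen x c hs h ih =>
    rw [IsSentence] at ih
    exact isSentence_all.2 ((freeVars_replaceConst x c _).trans (by simp [ih]))
  | reg_box _ ih => exact isSentence_imp.2 (isSentence_imp.1 ih)
  | reg_dia _ ih => exact isSentence_imp.2 (isSentence_imp.1 ih)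

/-- The substitution sending the first three atoms to the given formulas. -/
def threeAtoms (φ ψ χ : Formula σ) : ℕ → Formula σ
  | 0 => φ
  | 1 => ψ
  | _ => χ

theorem isSentence_threeAtoms (hφ : φ.IsSentence) (hψ : ψ.IsSentence) (hχ : χ.IsSentence) (n : ℕ) :
    (threeAtoms φ ψ χ n).IsSentence := by
  match n with
  | 0 => exact hφ
  | 1 => exact hψ
  | _ + 2 => exact hχ

theorem k (hφ : φ.IsSentence) (hψ : ψ.IsSentence) : Thm (φ.imp (ψ.imp φ)) :=
  intuit _ _ (IPC.k (.atom 0) (.atom 1)) (isSentence_threeAtoms hφ hψ hψ)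

theorem s (hφ : φ.IsSentence) (hψ : ψ.IsSentence) (hχ : χ.IsSentence) :
    Thm ((φ.imp (ψ.imp χ)).imp ((φ.imp ψ).imp (φ.imp χ))) :=
  intuit _ _ (IPC.s (.atom 0) (.atom 1) (.atom 2)) (isSentence_threeAtoms hφ hψ hχ)

theorem and_left (hφ : φ.IsSentence) (hψ : ψ.IsSentence) : Thm ((φ.and ψ).imp φ) :=
  intuit _ _ (IPC.and_left (.atom 0) (.atom 1)) (isSentence_threeAtoms hφ hψ hψ)

theorem and_right (hφ : φ.IsSentence) (hψ : ψ.IsSentence) : Thm ((φ.and ψ).imp ψ) :=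
  intuit _ _ (IPC.and_right (.atom 0) (.atom 1)) (isSentence_threeAtoms hφ hψ hψ)

theorem and_intro (hφ : φ.IsSentence) (hψ : ψ.IsSentence) : Thm (φ.imp (ψ.imp (φ.and ψ))) :=
  intuit _ _ (IPC.and_intro (.atom 0) (.atom 1)) (isSentence_threeAtoms hφ hψ hψ)

theorem or_left (hφ : φ.IsSentence) (hψ : ψ.IsSentence) : Thm (φ.imp (φ.or ψ)) :=
  intuit _ _ (IPC.or_left (.atom 0) (.atom 1)) (isSentence_threeAtoms hφ hψ hψ)

theorem or_right (hφ : φ.IsSentence) (hψ : ψ.IsSentence) : Thm (ψ.imp (φ.or ψ)) :=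
  intuit _ _ (IPC.or_right (.atom 0) (.atom 1)) (isSentence_threeAtoms hφ hψ hψ)

theorem or_elim (hφ : φ.IsSentence) (hψ : ψ.IsSentence) (hχ : χ.IsSentence) :
    Thm ((φ.imp χ).imp ((ψ.imp χ).imp ((φ.or ψ).imp χ))) :=
  intuit _ _ (IPC.or_elim (.atom 0) (.atom 1) (.atom 2)) (isSentence_threeAtoms hφ hψ hχ)

theorem exfalso (hφ : φ.IsSentence) : Thm (bot.imp φ) :=
  intuit _ _ (IPC.exfalso (.atom 0)) (isSentence_threeAtoms hφ hφ hφ)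

theorem imp_of (hψ : ψ.IsSentence) (h : Thm φ) : Thm (ψ.imp φ) := mp (k h.isSentence hψ) h

theorem imp_mp (h : Thm (φ.imp (ψ.imp χ))) (h' : Thm (φ.imp ψ)) : Thm (φ.imp χ) := by
  have h1 := isSentence_imp.1 h.isSentence
  have h2 := isSentence_imp.1 h1.2
  exact mp (mp (s h1.1 h2.1 h2.2) h) h'

theorem imp_self (hφ : φ.IsSentence) : Thm (φ.imp φ) :=
  imp_mp (k hφ (isSentence_imp.2 ⟨hφ, hφ⟩)) (k hφ hφ)

theorem imp_trans (h : Thm (φ.imp ψ)) (h' : Thm (ψ.imp χ)) : Thm (φ.imp χ) :=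
  imp_mp (imp_of (isSentence_imp.1 h.isSentence).1 h') h

theorem imp_and (h : Thm (φ.imp ψ)) (h' : Thm (φ.imp χ)) : Thm (φ.imp (ψ.and χ)) :=
  imp_mp (imp_trans h (and_intro (isSentence_imp.1 h.isSentence).2
    (isSentence_imp.1 h'.isSentence).2)) h'

theorem top : Thm (Formula.top : Formula σ) := imp_self rfl

theorem curry (h : Thm ((φ.and ψ).imp χ)) : Thm (φ.imp (ψ.imp χ)) := by
  have h1 := isSentence_imp.1 h.isSentence
  have h2 := isSentence_and.1 h1.1
  exact imp_trans (and_intro h2.1 h2.2) (mp (s h2.2 h1.1 h1.2) (imp_of h2.2 h))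

theorem uncurry (h : Thm (φ.imp (ψ.imp χ))) : Thm ((φ.and ψ).imp χ) := by
  have h1 := isSentence_imp.1 h.isSentence
  have h2 := isSentence_imp.1 h1.2
  exact imp_mp (imp_trans (and_left h1.1 h2.1) h) (and_right h1.1 h2.1)

theorem swap (h : Thm (φ.imp (ψ.imp χ))) : Thm (ψ.imp (φ.imp χ)) := by
  have h1 := isSentence_imp.1 h.isSentence
  have h2 := isSentence_imp.1 h1.2
  exact curry (imp_trans (imp_and (and_right h2.1 h1.1) (and_left h2.1 h1.1)) (uncurry h))

theorem rename (h : Thm φ) (f : σ.Const → σ.Const) : Thm (φ.rename f) := by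
  classical
  induction h generalizing f with
  | intuit A θ hA hθ =>
    have key : (A.inst θ).rename f = A.inst fun n => (θ n).rename f := by
      clear hA
      induction A <;> simp_all [PropFormula.inst, Formula.rename]
    rw [key]
    exact intuit A _ hA fun n => by rw [IsSentence, freeVars_rename]; exact hθ n
  | box_and φ ψ h1 h2 =>
    exact box_and _ _ (by rwa [IsSentence, freeVars_rename]) (by rwa [IsSentence, freeVars_rename])
  | box_top => exact box_top
  | dia_or φ ψ h1 h2 =>
    exact dia_or _ _ (by rwa [IsSentence, freeVars_rename]) (by rwa [IsSentence, freeVars_rename])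
  | dia_bot => exact dia_bot
  | fs1 φ ψ h1 h2 =>
    exact fs1 _ _ (by rwa [IsSentence, freeVars_rename]) (by rwa [IsSentence, freeVars_rename])
  | fs2 φ ψ h1 h2 =>
    exact fs2 _ _ (by rwa [IsSentence, freeVars_rename]) (by rwa [IsSentence, freeVars_rename])
  | univ x φ c h =>
    simp only [Formula.rename, rename_subst]
    exact univ x _ _ (by rwa [FreeOnlyIn, freeVars_rename])
  | exist x φ c h =>
    simp only [Formula.rename, rename_subst]
    exact exist x _ _ (by rwa [FreeOnlyIn, freeVars_rename])
  | all_ex x φ ψ h1 h2 =>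
    exact all_ex x _ _ (by rwa [FreeOnlyIn, freeVars_rename])
      (by rwa [IsSentence, freeVars_rename])
  | all_imp x φ ψ h1 h2 =>
    exact all_imp x _ _ (by rwa [IsSentence, freeVars_rename])
      (by rwa [FreeOnlyIn, freeVars_rename])
  | id_refl c => exact id_refl _
  | id_sub x φ c₁ c₂ h hm =>
    simp only [Formula.rename, rename_subst]
    exact id_sub x _ _ _ (by rwa [FreeOnlyIn, freeVars_rename]) hm.rename
  | mp _ _ h1 h2 => exact mp (h1 f) (h2 f)
  | @gen x c φ hs h ih =>
    have := σ.infinite_const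
    -- The induction is over all renamings, so its hypothesis applies to `f` altered to send `c` to
    -- a constant outside the image of the constants of `φ`. Hence `f` need not be injective.
    obtain ⟨c', hc'⟩ := ((finite_hasConst φ).image f).exists_notMem
    have hne : ∀ d, φ.HasConst d → d ≠ c → f d ≠ c' :=
      fun d hd _ e => hc' ⟨d, hd, e⟩
    simp only [Formula.rename]
    rw [← replaceConst_rename_update hne]
    exact gen x c' (hs.rename_update hne) (ih _)
  | reg_box _ ih => exact reg_box (ih f)
  | reg_dia _ ih => exact reg_dia (ih f)

/-- A constant foreign to `φ` plays the role of an eigenvariable: generalising on it undoes the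
substitution. -/
theorem all_of_subst {x : ℕ} {c : σ.Const} (hc : ¬ φ.HasConst c) (h : Thm (φ.subst x c)) :
    Thm (all x φ) := by
  have := gen x c (substitutable_subst hc) h
  rwa [replaceConst_subst hc] at this

theorem freeOnlyIn_of_isSentence_subst {x : ℕ} {c : σ.Const} (h : (φ.subst x c).IsSentence) :
    φ.FreeOnlyIn x := by
  rw [IsSentence, freeVars_subst] at h
  exact isSentence_all.1 h

theorem ex_imp {x : ℕ} {c : σ.Const} (hφ : ¬ φ.HasConst c) (hψ : ¬ ψ.HasConst c)
    (h : Thm ((φ.subst x c).imp ψ)) : Thm ((ex x φ).imp ψ) := by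
  have hs := isSentence_imp.1 h.isSentence
  refine mp (all_ex x φ ψ (freeOnlyIn_of_isSentence_subst hs.1) hs.2) ?_
  refine all_of_subst (c := c) (fun h => h.elim hφ hψ) ?_
  simpa only [subst, hs.2.subst_eq] using h

theorem imp_all {x : ℕ} {c : σ.Const} (hφ : ¬ φ.HasConst c) (hψ : ¬ ψ.HasConst c)
    (h : Thm (φ.imp (ψ.subst x c))) : Thm (φ.imp (all x ψ)) := by
  have hs := isSentence_imp.1 h.isSentence
  refine mp (all_imp x φ ψ hs.1 (freeOnlyIn_of_isSentence_subst hs.2)) ?_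
  refine all_of_subst (c := c) (fun h => h.elim hφ hψ) ?_
  simpa only [subst, hs.1.subst_eq] using h

end Thm

theorem isSentence_conj {L : List (Formula σ)} : (conj L).IsSentence ↔ ∀ γ ∈ L, γ.IsSentence := by
  induction L with
  | nil => simp [conj, isSentence_top]
  | cons φ L ih => simp [conj, isSentence_and, ih]

theorem hasConst_conj {L : List (Formula σ)} {c : σ.Const} :
    (conj L).HasConst c ↔ ∃ γ ∈ L, γ.HasConst c := by
  induction L with
  | nil => simp [conj, top, neg, HasConst]
  | cons φ L ih => simp [conj, HasConst, ih]

theorem thm_conj_imp {L : List (Formula σ)} (hL : ∀ γ ∈ L, γ.IsSentence) {φ : Formula σ}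
    (hφ : φ ∈ L) : Thm ((conj L).imp φ) := by
  induction L with
  | nil => simp at hφ
  | cons ψ L ih =>
    simp only [List.mem_cons, forall_eq_or_imp] at hL
    have hs := isSentence_conj.2 hL.2
    rcases List.mem_cons.1 hφ with rfl | h
    · exact Thm.and_left hL.1 hs
    · exact (Thm.and_right hL.1 hs).imp_trans (ih hL.2 h)

theorem thm_imp_conj {L : List (Formula σ)} {φ : Formula σ} (hφ : φ.IsSentence)
    (h : ∀ γ ∈ L, Thm (φ.imp γ)) : Thm (φ.imp (conj L)) := by
  induction L with
  | nil => exact Thm.imp_of hφ Thm.top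
  | cons ψ L ih =>
    simp only [List.mem_cons, forall_eq_or_imp] at h
    exact Thm.imp_and h.1 (ih h.2)

/-! ### Derivability from a set of hypotheses -/

namespace Proves

variable {Γ Γ' : Set (Formula σ)} {φ ψ χ : Formula σ}

theorem isSentence (h : Proves Γ φ) : φ.IsSentence := by
  obtain ⟨L, -, h⟩ := h
  exact (isSentence_imp.1 h.isSentence).2

theorem of_thm (h : Thm φ) : Proves Γ φ := ⟨[], by simp, Thm.imp_of rfl h⟩

theorem of_mem (hφ : φ.IsSentence) (h : φ ∈ Γ) : Proves Γ φ :=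
  ⟨[φ], by simpa using h, Thm.and_left hφ rfl⟩

theorem mono (h : Γ ⊆ Γ') (hφ : Proves Γ φ) : Proves Γ' φ := by
  obtain ⟨L, hL, hφ⟩ := hφ
  exact ⟨L, fun γ hγ => h (hL γ hγ), hφ⟩

theorem mp (h : Proves Γ (φ.imp ψ)) (h' : Proves Γ φ) : Proves Γ ψ := by
  obtain ⟨L, hL, h⟩ := h
  obtain ⟨L', hL', h'⟩ := h'
  have hs := isSentence_conj.1 (isSentence_imp.1 h.isSentence).1
  have hs' := isSentence_conj.1 (isSentence_imp.1 h'.isSentence).1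
  have hall : ∀ γ ∈ L ++ L', γ.IsSentence := by
    simp only [List.mem_append]
    exact fun γ hγ => hγ.elim (hs γ) (hs' γ)
  refine ⟨L ++ L', ?_, ?_⟩
  · simp only [List.mem_append]
    exact fun γ hγ => hγ.elim (hL γ) (hL' γ)
  · have e1 : Thm ((conj (L ++ L')).imp (conj L)) := thm_imp_conj (isSentence_conj.2 hall)
      fun γ hγ => thm_conj_imp hall (List.mem_append_left _ hγ)
    have e2 : Thm ((conj (L ++ L')).imp (conj L')) := thm_imp_conj (isSentence_conj.2 hall)
      fun γ hγ => thm_conj_imp hall (List.mem_append_right _ hγ)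
    exact (e1.imp_trans h).imp_mp (e2.imp_trans h')

theorem mp_thm (h : Proves Γ φ) (h' : Thm (φ.imp ψ)) : Proves Γ ψ := (of_thm h').mp h

theorem intro (hφ : φ.IsSentence) (h : Proves (insert φ Γ) ψ) : Proves Γ (φ.imp ψ) := by
  classical
  obtain ⟨L, hL, h⟩ := h
  have hs := isSentence_conj.1 (isSentence_imp.1 h.isSentence).1
  have hs' : ∀ γ ∈ L.filter (· ≠ φ), γ.IsSentence := fun γ hγ => hs γ (List.mem_filter.1 hγ).1
  refine ⟨L.filter (· ≠ φ), fun γ hγ => ?_, ?_⟩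
  · obtain ⟨h1, h2⟩ := List.mem_filter.1 hγ
    exact (hL γ h1).resolve_left (by simpa using h2)
  · have hall : ((conj (L.filter (· ≠ φ))).and φ).IsSentence :=
      isSentence_and.2 ⟨isSentence_conj.2 hs', hφ⟩
    refine Thm.curry (Thm.imp_trans (thm_imp_conj hall fun γ hγ => ?_) h)
    by_cases e : γ = φ
    · subst e
      exact Thm.and_right (isSentence_conj.2 hs') hφ
    · exact (Thm.and_left (isSentence_conj.2 hs') hφ).imp_trans
        (thm_conj_imp hs' (List.mem_filter.2 ⟨hγ, by simpa using e⟩))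

theorem and_intro (h : Proves Γ φ) (h' : Proves Γ ψ) : Proves Γ (φ.and ψ) :=
  mp (h.mp_thm (Thm.and_intro h.isSentence h'.isSentence)) h'

theorem and_left (h : Proves Γ (φ.and ψ)) : Proves Γ φ :=
  h.mp_thm (Thm.and_left (isSentence_and.1 h.isSentence).1 (isSentence_and.1 h.isSentence).2)

theorem and_right (h : Proves Γ (φ.and ψ)) : Proves Γ ψ :=
  h.mp_thm (Thm.and_right (isSentence_and.1 h.isSentence).1 (isSentence_and.1 h.isSentence).2)

theorem or_left (hψ : ψ.IsSentence) (h : Proves Γ φ) : Proves Γ (φ.or ψ) :=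
  h.mp_thm (Thm.or_left h.isSentence hψ)

theorem or_right (hφ : φ.IsSentence) (h : Proves Γ ψ) : Proves Γ (φ.or ψ) :=
  h.mp_thm (Thm.or_right hφ h.isSentence)

theorem or_imp (h : Proves Γ (φ.imp χ)) (h' : Proves Γ (ψ.imp χ)) : Proves Γ ((φ.or ψ).imp χ) :=
  (h.mp_thm (Thm.or_elim (isSentence_imp.1 h.isSentence).1 (isSentence_imp.1 h'.isSentence).1
    (isSentence_imp.1 h.isSentence).2)).mp h'

theorem imp_trans (h : Proves Γ (φ.imp ψ)) (h' : Proves Γ (ψ.imp χ)) : Proves Γ (φ.imp χ) := by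
  have h1 := (isSentence_imp.1 h.isSentence).1
  have hsub := Set.subset_insert φ Γ
  exact intro h1 ((h'.mono hsub).mp ((h.mono hsub).mp (of_mem h1 (Set.mem_insert _ _))))

theorem imp_of (hψ : ψ.IsSentence) (h : Proves Γ φ) : Proves Γ (ψ.imp φ) :=
  h.mp_thm (Thm.k h.isSentence hψ)

theorem imp_and (h : Proves Γ (φ.imp ψ)) (h' : Proves Γ (φ.imp χ)) :
    Proves Γ (φ.imp (ψ.and χ)) := by
  have h1 := (isSentence_imp.1 h.isSentence).1
  have hsub := Set.subset_insert φ Γ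
  have hm : Proves (insert φ Γ) φ := of_mem h1 (Set.mem_insert _ _)
  exact intro h1 (((h.mono hsub).mp hm).and_intro ((h'.mono hsub).mp hm))

theorem curry (h : Proves Γ ((φ.and ψ).imp χ)) : Proves Γ (φ.imp (ψ.imp χ)) := by
  have h1 := isSentence_and.1 (isSentence_imp.1 h.isSentence).1
  refine intro h1.1 (intro h1.2 ((h.mono ?_).mp (and_intro (of_mem h1.1 ?_) (of_mem h1.2 ?_))))
  · exact (Set.subset_insert _ _).trans (Set.subset_insert _ _)
  · simp
  · simp

theorem uncurry (h : Proves Γ (φ.imp (ψ.imp χ))) : Proves Γ ((φ.and ψ).imp χ) := by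
  have h1 := isSentence_imp.1 h.isSentence
  have h2 := isSentence_imp.1 h1.2
  have hs := isSentence_and.2 ⟨h1.1, h2.1⟩
  have hm : Proves (insert (φ.and ψ) Γ) (φ.and ψ) := of_mem hs (Set.mem_insert _ _)
  exact intro hs (((h.mono (Set.subset_insert _ _)).mp hm.and_left).mp hm.and_right)

/-- The deduction theorem for a set: the finitely many hypotheses used from `Ξ` move into one
antecedent. -/
theorem exists_conj {Ξ : Set (Formula σ)} (h : Proves (Γ ∪ Ξ) φ) :
    ∃ L : List (Formula σ), (∀ γ ∈ L, γ ∈ Ξ) ∧ Proves Γ ((conj L).imp φ) := by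
  classical
  obtain ⟨L, hL, h⟩ := h
  have hs := isSentence_conj.1 (isSentence_imp.1 h.isSentence).1
  have hs1 : ∀ γ ∈ L.filter (· ∈ Ξ), γ.IsSentence := fun γ hγ => hs γ (List.mem_filter.1 hγ).1
  have hs2 : ∀ γ ∈ L.filter (· ∉ Ξ), γ.IsSentence := fun γ hγ => hs γ (List.mem_filter.1 hγ).1
  refine ⟨L.filter (· ∈ Ξ), fun γ hγ => by simpa using (List.mem_filter.1 hγ).2,
    L.filter (· ∉ Ξ), fun γ hγ => ?_, ?_⟩
  · obtain ⟨h1, h2⟩ := List.mem_filter.1 hγ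
    exact (hL γ h1).resolve_right (by simpa using h2)
  · have h1 := isSentence_conj.2 hs1
    have h2 := isSentence_conj.2 hs2
    refine Thm.curry (Thm.imp_trans (thm_imp_conj (isSentence_and.2 ⟨h2, h1⟩) fun γ hγ => ?_) h)
    by_cases e : γ ∈ Ξ
    · exact (Thm.and_right h2 h1).imp_trans
        (thm_conj_imp hs1 (List.mem_filter.2 ⟨hγ, by simpa using e⟩))
    · exact (Thm.and_left h2 h1).imp_trans
        (thm_conj_imp hs2 (List.mem_filter.2 ⟨hγ, by simpa using e⟩))

theorem thm (h : Proves ∅ φ) : Thm φ := by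
  obtain ⟨L, hL, h⟩ := h
  obtain rfl : L = [] := List.eq_nil_iff_forall_not_mem.2 fun γ hγ => hL γ hγ
  exact h.mp Thm.top

theorem box_mono (h : Proves Γ (box φ)) (h' : Thm (φ.imp ψ)) : Proves Γ (box ψ) :=
  h.mp_thm (Thm.reg_box h')

theorem box_and (h : Proves Γ (box φ)) (h' : Proves Γ (box ψ)) : Proves Γ (box (φ.and ψ)) :=
  ((of_thm (Thm.box_and φ ψ h.isSentence h'.isSentence)).and_right).mp (h.and_intro h')

theorem ex_imp {x : ℕ} {c : σ.Const} (hΓ : ∀ γ ∈ Γ, ¬ γ.HasConst c) (hφ : ¬ φ.HasConst c)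
    (hψ : ¬ ψ.HasConst c) (h : Proves Γ ((φ.subst x c).imp ψ)) : Proves Γ ((ex x φ).imp ψ) := by
  obtain ⟨L, hL, h⟩ := h
  have hc : ¬ (conj L).HasConst c := by
    rw [hasConst_conj]
    rintro ⟨γ, h1, h2⟩
    exact hΓ γ (hL γ h1) h2
  exact ⟨L, hL, Thm.swap (Thm.ex_imp hφ (fun h => h.elim hc hψ) h.swap)⟩

theorem all_intro {x : ℕ} {c : σ.Const} (hΓ : ∀ γ ∈ Γ, ¬ γ.HasConst c) (hφ : ¬ φ.HasConst c)
    (h : Proves Γ (φ.subst x c)) : Proves Γ (all x φ) := by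
  obtain ⟨L, hL, h⟩ := h
  have hc : ¬ (conj L).HasConst c := by
    rw [hasConst_conj]
    rintro ⟨γ, h1, h2⟩
    exact hΓ γ (hL γ h1) h2
  exact ⟨L, hL, Thm.imp_all hc hφ h⟩

theorem rename (h : Proves Γ φ) (f : σ.Const → σ.Const) :
    Proves (Formula.rename f '' Γ) (φ.rename f) := by
  obtain ⟨L, hL, h⟩ := h
  have key : (conj L).rename f = conj (L.map (Formula.rename f)) := by
    clear h hL
    induction L with
    | nil => rfl
    | cons φ L ih => simp [conj, Formula.rename, ih]
  refine ⟨L.map (Formula.rename f), ?_, ?_⟩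
  · simp only [List.mem_map]
    rintro _ ⟨γ, hγ, rfl⟩
    exact ⟨γ, hL γ hγ, rfl⟩
  · rw [← key]
    exact h.rename f

theorem exists_of_iUnion {Δ : ℕ → Set (Formula σ)} (hΔ : Monotone Δ) (h : Proves (⋃ k, Δ k) φ) :
    ∃ k, Proves (Δ k) φ := by
  obtain ⟨L, hL, h⟩ := h
  suffices ∃ k, ∀ γ ∈ L, γ ∈ Δ k from this.imp fun k hk => ⟨L, hk, h⟩
  clear h
  induction L with
  | nil => exact ⟨0, by simp⟩
  | cons γ L ih =>
    simp only [List.mem_cons, forall_eq_or_imp, Set.mem_iUnion] at hL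
    obtain ⟨⟨k, hk⟩, hL⟩ := hL
    obtain ⟨k', hk'⟩ := ih fun γ hγ => Set.mem_iUnion.2 (hL γ hγ)
    refine ⟨max k k', ?_⟩
    simp only [List.mem_cons, forall_eq_or_imp]
    exact ⟨hΔ (le_max_left _ _) hk, fun γ hγ => hΔ (le_max_right _ _) (hk' γ hγ)⟩

end Proves

/-! ### Quantifying constants out existentially -/

/-- `θ` is a weakest consequence of `φ` among the formulas without constants from `S`. -/
structure IsProjection (S : Set σ.Const) (φ θ : Formula σ) : Prop where
  mem : θ ∈ sentences {c | φ.HasConst c ∧ c ∉ S}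
  imp : Thm (φ.imp θ)
  elim : ∀ (Γ : Set (Formula σ)) (ψ : Formula σ), (∀ γ ∈ Γ, ∀ c ∈ S, ¬ γ.HasConst c) →
    (∀ c ∈ S, ¬ ψ.HasConst c) → Proves Γ (φ.imp ψ) → Proves Γ (θ.imp ψ)

/-- The projection is `∃y φ'`, where `φ'` is `φ` with `c` replaced by a variable `y` that occurs
nowhere in `φ`, free or bound, so that substituting `c` back recovers `φ`. -/
theorem exists_isProjection_singleton (c : σ.Const) {φ : Formula σ} (hφ : φ.IsSentence) :
    ∃ θ, IsProjection {c} φ θ := by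
  obtain ⟨y, hy⟩ := Infinite.exists_notMem_finset φ.vars
  have hsub := subst_replaceConst (c := c) hy
  have hfree : (φ.replaceConst c y).FreeOnlyIn y := by
    refine (freeVars_replaceConst y c φ).trans ?_
    rw [IsSentence] at hφ
    simp [hφ]
  have hc : ¬ (φ.replaceConst c y).HasConst c := fun h => h.of_replaceConst.2 rfl
  refine ⟨ex y (φ.replaceConst c y), ⟨isSentence_ex.2 hfree, fun d hd => ?_⟩, ?_, ?_⟩
  · exact HasConst.of_replaceConst hd
  · have := Thm.exist y _ c hfree
    rwa [hsub] at this
  · intro Γ ψ hΓ hψ h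
    refine Proves.ex_imp (c := c) (fun γ hγ => hΓ γ hγ c rfl) hc (hψ c rfl) ?_
    rwa [hsub]

theorem exists_isProjection (S : Set σ.Const) {φ : Formula σ} (hφ : φ.IsSentence) :
    ∃ θ, IsProjection S φ θ := by
  -- Only finitely many constants of `S` occur in `φ`; they are quantified out one at a time, while
  -- `Γ` and `ψ` avoid all of `S` throughout.
  have key : ∀ F : Set σ.Const, F.Finite → F ⊆ S → ∃ θ, θ ∈ sentences {c | φ.HasConst c ∧ c ∉ F} ∧
      Thm (φ.imp θ) ∧ ∀ (Γ : Set (Formula σ)) (ψ : Formula σ),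
        (∀ γ ∈ Γ, ∀ c ∈ S, ¬ γ.HasConst c) → (∀ c ∈ S, ¬ ψ.HasConst c) →
        Proves Γ (φ.imp ψ) → Proves Γ (θ.imp ψ) := by
    intro F hF
    induction F, hF using Set.Finite.induction_on with
    | empty =>
      exact fun _ => ⟨φ, ⟨hφ, fun c hc => ⟨hc, by simp⟩⟩, Thm.imp_self hφ, fun _ _ _ _ h => h⟩
    | @insert c F _ _ ih =>
      intro hS
      obtain ⟨θ, h1, h2, h3⟩ := ih ((Set.subset_insert _ _).trans hS)
      obtain ⟨θ', h1', h2', h3'⟩ := exists_isProjection_singleton c h1.1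
      refine ⟨θ', ⟨h1'.1, fun d hd => ?_⟩, h2.imp_trans h2', fun Γ ψ hΓ hψ h => ?_⟩
      · obtain ⟨h4, h5⟩ := h1'.2 d hd
        obtain ⟨h6, h7⟩ := h1.2 d h4
        exact ⟨h6, by simpa using ⟨h5, h7⟩⟩
      · have hcS : c ∈ S := hS (Set.mem_insert _ _)
        exact h3' Γ ψ (fun γ hγ d hd => hΓ γ hγ d (hd ▸ hcS)) (fun d hd => hψ d (hd ▸ hcS))
          (h3 Γ ψ hΓ hψ h)
  obtain ⟨θ, h1, h2, h3⟩ := key {c | φ.HasConst c ∧ c ∈ S}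
    ((finite_hasConst φ).subset fun c hc => hc.1) fun c hc => hc.2
  exact ⟨θ, ⟨h1.1, fun c hc => ⟨(h1.2 c hc).1, fun hS => (h1.2 c hc).2 ⟨(h1.2 c hc).1, hS⟩⟩⟩, h2, h3⟩

open Formula

/-! ## Chains of theories -/

/-- The chain of theories `Δ 0, …, Δ n`, the `i`-th one in the language with constants `C i`,
together with the sentence `B` in the `i`-th place, proves a member of `N` in the `n`-th place. -/
inductive Refutes (C : ℕ → Set σ.Const) (n : ℕ) (N : Set (Formula σ)) (Δ : ℕ → Set (Formula σ)) :
    ℕ → Formula σ → Prop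
  | base {B E : Formula σ} : E ∈ N → Proves (Δ n) (B.imp E) → Refutes C n N Δ n B
  | step {i : ℕ} {B D : Formula σ} : D ∈ sentences (C i) → Refutes C n N Δ (i + 1) D →
      Proves (Δ i) (B.imp (box D)) → Refutes C n N Δ i B

/-- The set `N` is directed with respect to provable implication. -/
def ImpDirected (N : Set (Formula σ)) : Prop :=
  ∀ E ∈ N, ∀ E' ∈ N, ∃ E'' ∈ N, Thm (E.imp E'') ∧ Thm (E'.imp E'')

/-- The chain `Δ` with the formula `φ` added in the `j`-th place. -/
def addAt (Δ : ℕ → Set (Formula σ)) (j : ℕ) (φ : Formula σ) : ℕ → Set (Formula σ) :=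
  Function.update Δ j (insert φ (Δ j))

theorem addAt_self (Δ : ℕ → Set (Formula σ)) (j : ℕ) (φ : Formula σ) :
    addAt Δ j φ j = insert φ (Δ j) := Function.update_self ..

theorem addAt_of_ne {Δ : ℕ → Set (Formula σ)} {i j : ℕ} {φ : Formula σ} (h : i ≠ j) :
    addAt Δ j φ i = Δ i := Function.update_of_ne h ..

theorem le_addAt (Δ : ℕ → Set (Formula σ)) (j : ℕ) (φ : Formula σ) : Δ ≤ addAt Δ j φ := by
  intro i
  by_cases h : i = j
  · subst h
    rw [addAt_self]
    exact Set.subset_insert _ _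
  · rw [addAt_of_ne h]

theorem mem_addAt {Δ : ℕ → Set (Formula σ)} {i j : ℕ} {φ ψ : Formula σ} :
    ψ ∈ addAt Δ j φ i ↔ (i = j ∧ ψ = φ) ∨ ψ ∈ Δ i := by
  by_cases h : i = j
  · subst h
    simp [addAt_self]
  · simp [addAt_of_ne h, h]

theorem addAt_le {Δ Δ' : ℕ → Set (Formula σ)} {j : ℕ} {φ : Formula σ} (h : Δ ≤ Δ')
    (hφ : φ ∈ Δ' j) : addAt Δ j φ ≤ Δ' := by
  intro i ψ hψ
  rcases mem_addAt.1 hψ with ⟨rfl, rfl⟩ | hψ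
  · exact hφ
  · exact h i hψ

theorem addAt_mono {Δ Δ' : ℕ → Set (Formula σ)} {j : ℕ} {φ : Formula σ} (h : Δ ≤ Δ') :
    addAt Δ j φ ≤ addAt Δ' j φ :=
  addAt_le (h.trans (le_addAt _ _ _)) (mem_addAt.2 (Or.inl ⟨rfl, rfl⟩))

/-- The constants of the languages below the `j`-th one. -/
def constsBelow (C : ℕ → Set σ.Const) (j : ℕ) : Set σ.Const := ⋃ i < j, C i

theorem subset_constsBelow (C : ℕ → Set σ.Const) (i : ℕ) :
    C i ⊆ constsBelow C (i + 1) :=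
  fun _ hc => Set.mem_iUnion₂.2 ⟨i, Nat.lt_succ_self i, hc⟩

/-! ### Transformations of refutations -/

namespace Refutes

variable {C : ℕ → Set σ.Const} {n : ℕ} {N : Set (Formula σ)} {Δ Δ' : ℕ → Set (Formula σ)}
  {i j : ℕ} {B B' φ ψ : Formula σ}

theorem isSentence (h : Refutes C n N Δ i B) : B.IsSentence := by
  cases h with
  | base _ h => exact (isSentence_imp.1 h.isSentence).1
  | step _ _ h => exact (isSentence_imp.1 h.isSentence).1

theorem le (h : Refutes C n N Δ i B) : i ≤ n := by
  induction h with
  | base => exact le_rfl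
  | step _ _ _ ih => omega

theorem exists_of_lt (h : Refutes C n N Δ i B) (hi : i < n) :
    ∃ D ∈ sentences (C i), Refutes C n N Δ (i + 1) D ∧ Proves (Δ i) (B.imp (box D)) := by
  cases h with
  | base => omega
  | step hD hR hB => exact ⟨_, hD, hR, hB⟩

theorem exists_of_eq (h : Refutes C n N Δ i B) (hi : i = n) :
    ∃ E ∈ N, Proves (Δ n) (B.imp E) := by
  cases h with
  | base hE hB => exact ⟨_, hE, hB⟩
  | step _ hR _ => exact absurd hR.le (by omega)

theorem of_imp (h : Refutes C n N Δ i B) (h' : Proves (Δ i) (B'.imp B)) :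
    Refutes C n N Δ i B' := by
  cases h with
  | base hE hB => exact base hE (h'.imp_trans hB)
  | step hD hR hB => exact step hD hR (h'.imp_trans hB)

/-- Interpolants are joined place by place, since `□D` and `□D'` each imply `□(D ∨ D')`; at the last
place directedness of `N` supplies a common conclusion. -/
theorem or (hN : ImpDirected N) (h : Refutes C n N Δ i B) (h' : Refutes C n N Δ i B') :
    Refutes C n N Δ i (B.or B') := by
  induction h generalizing B' with
  | @base B E hE hB =>
    cases h' with
    | @base _ E' hE' hB' =>
      obtain ⟨E'', h1, h2, h3⟩ := hN E hE E' hE'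
      exact base h1 ((hB.imp_trans (.of_thm h2)).or_imp (hB'.imp_trans (.of_thm h3)))
    | step _ hR _ => exact absurd hR.le (by omega)
  | @step i B D hD hR hB ih =>
    cases h' with
    | base => exact absurd hR.le (by omega)
    | @step _ _ D' hD' hR' hB' =>
      refine step (or_mem_sentences.2 ⟨hD, hD'⟩) (ih hR') (Proves.or_imp ?_ ?_)
      · exact hB.imp_trans (.of_thm (Thm.reg_box (Thm.or_left hD.1 hD'.1)))
      · exact hB'.imp_trans (.of_thm (Thm.reg_box (Thm.or_right hD.1 hD'.1)))

theorem top_zero (h : Refutes C n N Δ i top) : Refutes C n N Δ 0 top := by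
  induction i with
  | zero => exact h
  | succ i ih =>
    exact ih (step top_mem_sentences h (.of_thm (Thm.imp_of rfl Thm.box_top)))

theorem mono (hΔ : Δ ≤ Δ') (h : Refutes C n N Δ i B) : Refutes C n N Δ' i B := by
  induction h with
  | base hE hB => exact base hE (hB.mono (hΔ _))
  | step hD _ hB ih => exact step hD ih (hB.mono (hΔ _))

theorem congr (hΔ : ∀ m, i ≤ m → Δ m = Δ' m) (h : Refutes C n N Δ i B) :
    Refutes C n N Δ' i B := by
  induction h with
  | base hE hB => exact base hE (hΔ _ le_rfl ▸ hB)
  | step hD _ hB ih => exact step hD (ih fun m hm => hΔ m (by omega)) (hΔ _ le_rfl ▸ hB)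

theorem exists_of_iUnion {Δ : ℕ → ℕ → Set (Formula σ)} (hΔ : Monotone Δ)
    (h : Refutes C n N (fun i => ⋃ k, Δ k i) i B) : ∃ k, Refutes C n N (Δ k) i B := by
  induction h with
  | base hE hB =>
    obtain ⟨k, hk⟩ := hB.exists_of_iUnion fun a b hab => hΔ hab n
    exact ⟨k, base hE hk⟩
  | @step i B D hD _ hB ih =>
    obtain ⟨k, hk⟩ := hB.exists_of_iUnion fun a b hab => hΔ hab i
    obtain ⟨k', hk'⟩ := ih
    exact ⟨max k k', step hD (hk'.mono (hΔ (le_max_right _ _)))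
      (hk.mono (hΔ (le_max_left _ _) _))⟩

/-- Every interpolant is replaced by its own projection `D'`. Since `D` implies `D'`, `□D` implies
`□D'`; and what follows from `D` and avoids `S` still follows from `D'`. -/
theorem projection {S : Set σ.Const} (hΔ : ∀ j, ∀ γ ∈ Δ j, ∀ c ∈ S, ¬ γ.HasConst c)
    (hN : ∀ E ∈ N, ∀ c ∈ S, ¬ E.HasConst c) (h : Refutes C n N Δ i B)
    (hB' : IsProjection S B B') : Refutes C n N Δ i B' := by
  induction h generalizing B' with
  | base hE hB => exact base hE (hB'.elim _ _ (hΔ _) (hN _ hE) hB)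
  | @step i B D hD _ hB ih =>
    obtain ⟨D', hD'⟩ := exists_isProjection S hD.1
    refine step ⟨hD'.mem.1, fun c hc => hD.2 c (hD'.mem.2 c hc).1⟩ (ih hD')
      (hB'.elim _ _ (hΔ _) (fun c hc h => (hD'.mem.2 c h).2 hc) ?_)
    exact hB.imp_trans (.of_thm (Thm.reg_box hD'.imp))

/-- A change at places `j` and beyond affects only the tail of a refutation, so it suffices to
repair that tail. The interpolant entering place `j` lies in the language of an earlier place, which
matters when a witness constant must be fresh for it. -/
theorem propagate (hΔ : ∀ m < j, Δ' m = Δ m)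
    (hj : ∀ B ∈ sentences (constsBelow C j), Refutes C n N Δ' j B → Refutes C n N Δ j B)
    (h : Refutes C n N Δ' 0 top) : Refutes C n N Δ 0 top := by
  suffices ∀ d i, i + d = j → ∀ B ∈ sentences (constsBelow C i), Refutes C n N Δ' i B →
      Refutes C n N Δ i B from this j 0 (by omega) top top_mem_sentences h
  intro d
  induction d with
  | zero =>
    rintro i rfl
    exact hj
  | succ d ih =>
    intro i hi B _ hB
    cases hB with
    | base hE h => exact base hE (by rwa [← hΔ n (by omega)])
    | step hD hR h =>
      exact step hD (ih (i + 1) (by omega) _ (sentences_mono (subset_constsBelow C i) hD) hR)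
        (by rwa [← hΔ i (by omega)])

/-- The deduction theorem at place `j`; the later places do not see `φ`. -/
theorem of_addAt_self (hφ : φ.IsSentence) (h : Refutes C n N (addAt Δ j φ) j B) :
    Refutes C n N Δ j (B.and φ) := by
  have hs := h.isSentence
  have key : ∀ E, Proves (addAt Δ j φ j) (B.imp E) → Proves (Δ j) ((B.and φ).imp E) := by
    intro E hE
    rw [addAt_self] at hE
    exact Proves.imp_trans (Proves.of_thm (Thm.imp_and (Thm.and_right hs hφ) (Thm.and_left hs hφ)))
      (Proves.uncurry (Proves.intro hφ hE))
  cases h with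
  | base hE hB => exact base hE (key _ hB)
  | step hD hR hB => exact step hD (hR.congr fun m hm => addAt_of_ne (by omega)) (key _ hB)

theorem of_addAt_proves (hφ : Proves (Δ j) φ) (h : Refutes C n N (addAt Δ j φ) 0 top) :
    Refutes C n N Δ 0 top := by
  refine h.propagate (j := j) (fun m hm => addAt_of_ne (by omega)) fun B hB hR => ?_
  exact (hR.of_addAt_self hφ.isSentence).of_imp
    ((Proves.of_thm (Thm.imp_self hB.1)).imp_and (hφ.imp_of hB.1))

/-- Before place `j` the two refutations run in parallel with conjoined interpolants, as `□`
commutes with `∧`. At `j` the disjunction splits into cases, and from there the tails are joined by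
`Refutes.or`. -/
theorem of_addAt_or (hN : ImpDirected N) (hor : φ.or ψ ∈ Δ j) (hs : (φ.or ψ).IsSentence)
    (h : Refutes C n N (addAt Δ j φ) 0 top) (h' : Refutes C n N (addAt Δ j ψ) 0 top) :
    Refutes C n N Δ 0 top := by
  have hs' := isSentence_or.1 hs
  suffices ∀ d i, i + d = j → ∀ B B', Refutes C n N (addAt Δ j φ) i B →
      Refutes C n N (addAt Δ j ψ) i B' → Refutes C n N Δ i (B.and B') from
    (this j 0 (by omega) top top h h').of_imp
      (.of_thm (Thm.imp_and (Thm.imp_self rfl) (Thm.imp_self rfl)))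
  intro d
  induction d with
  | zero =>
    rintro i rfl B B' hB hB'
    rw [Nat.add_zero] at hor hB hB'
    have hBs := hB.isSentence
    have hBs' := hB'.isSentence
    refine ((hB.of_addAt_self hs'.1).or hN (hB'.of_addAt_self hs'.2)).of_imp ?_
    have h1 : Thm (φ.imp ((B.and B').imp ((B.and φ).or (B'.and ψ)))) := by
      refine Thm.curry (Thm.imp_trans ?_ (Thm.or_left (isSentence_and.2 ⟨hBs, hs'.1⟩)
        (isSentence_and.2 ⟨hBs', hs'.2⟩)))
      have hBB := isSentence_and.2 ⟨hBs, hBs'⟩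
      exact Thm.imp_and ((Thm.and_right hs'.1 hBB).imp_trans (Thm.and_left hBs hBs'))
        (Thm.and_left hs'.1 hBB)
    have h2 : Thm (ψ.imp ((B.and B').imp ((B.and φ).or (B'.and ψ)))) := by
      refine Thm.curry (Thm.imp_trans ?_ (Thm.or_right (isSentence_and.2 ⟨hBs, hs'.1⟩)
        (isSentence_and.2 ⟨hBs', hs'.2⟩)))
      have hBB := isSentence_and.2 ⟨hBs, hBs'⟩
      exact Thm.imp_and ((Thm.and_right hs'.2 hBB).imp_trans (Thm.and_right hBs hBs'))
        (Thm.and_left hs'.2 hBB)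
    exact ((Proves.of_thm h1).or_imp (.of_thm h2)).mp (.of_mem hs hor)
  | succ d ih =>
    intro i hi B B' hB hB'
    have hBs := hB.isSentence
    have hBs' := hB'.isSentence
    have hne : ∀ χ, addAt Δ j χ i = Δ i := fun χ => addAt_of_ne (by omega)
    cases hB with
    | base hE h =>
      rw [hne] at h
      exact base hE ((Proves.of_thm (Thm.and_left hBs hBs')).imp_trans h)
    | @step _ _ D hD hR h =>
      cases hB' with
      | base => exact absurd hR.le (by omega)
      | @step _ _ D' hD' hR' h' =>
        rw [hne] at h h'
        refine step (and_mem_sentences.2 ⟨hD, hD'⟩) (ih (i + 1) (by omega) _ _ hR hR') ?_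
        have hbox : Thm (((box D).and (box D')).imp (box (D.and D'))) :=
          (Thm.mp (Thm.and_right
            (isSentence_and.1 (Thm.box_and D D' hD.1 hD'.1).isSentence).1
            (isSentence_and.1 (Thm.box_and D D' hD.1 hD'.1).isSentence).2)
            (Thm.box_and D D' hD.1 hD'.1))
        exact (((Proves.of_thm (Thm.and_left hBs hBs')).imp_trans h).imp_and
          ((Proves.of_thm (Thm.and_right hBs hBs')).imp_trans h')).imp_trans (.of_thm hbox)

/-- The formula `φ` is absorbed into the interpolant handed from place `j` to place `j + 1`. -/
theorem of_addAt_box (hφ : φ ∈ sentences (C j)) (hbox : box φ ∈ Δ j)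
    (h : Refutes C n N (addAt Δ (j + 1) φ) 0 top) : Refutes C n N Δ 0 top := by
  refine h.propagate (j := j) (fun m hm => addAt_of_ne (by omega)) fun B hB hR => ?_
  have hne : addAt Δ (j + 1) φ j = Δ j := addAt_of_ne (by omega)
  cases hR with
  -- Here `j = n`, and a formula added beyond the last place plays no part.
  | base hE h => exact base hE (addAt_of_ne (Δ := Δ) (show n ≠ n + 1 by omega) ▸ h)
  | @step _ _ D hD hR h =>
    rw [hne] at h
    refine step (and_mem_sentences.2 ⟨hD, hφ⟩) (hR.of_addAt_self hφ.1) ?_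
    refine Proves.intro hB.1 (Proves.box_and ?_ (.of_mem hφ.1 (Set.mem_insert_of_mem _ hbox)))
    exact (h.mono (Set.subset_insert _ _)).mp (.of_mem hB.1 (Set.mem_insert _ _))

/-- The interpolant `D` is weakened to `φ → D`. Place `j` proves its box by the axiom `(◇φ → □D) →
□(φ → D)`, and place `j + 1` recovers `D` because it contains `φ`. -/
theorem of_addAt_dia (hj : j < n) (hφ : φ ∈ sentences (C j)) (hmem : φ ∈ Δ (j + 1))
    (h : Refutes C n N (addAt Δ j (dia φ)) 0 top) : Refutes C n N Δ 0 top := by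
  refine h.propagate (j := j) (fun m hm => addAt_of_ne (by omega)) fun B hB hR => ?_
  cases hR with
  | base => omega
  | @step _ _ D hD hR h =>
    rw [addAt_self] at h
    have hR' : Refutes C n N Δ (j + 1) D := hR.congr fun m hm => addAt_of_ne (by omega)
    have hs : (φ.imp D).IsSentence := isSentence_imp.2 ⟨hφ.1, hD.1⟩
    refine step (imp_mem_sentences.2 ⟨hφ, hD⟩) (hR'.of_imp (B' := φ.imp D) ?_) ?_
    · refine Proves.intro hs ((Proves.of_mem hs (Set.mem_insert _ _)).mp ?_)
      exact .of_mem hφ.1 (Set.mem_insert_of_mem _ hmem)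
    · have h1 : Proves (Δ j) (B.imp ((dia φ).imp (box D))) := by
        have := Proves.intro (φ := dia φ) hφ.1 h
        exact Proves.curry (Proves.imp_trans (.of_thm (Thm.imp_and
          (Thm.and_right (φ := B) (ψ := dia φ) hB.1 hφ.1) (Thm.and_left hB.1 hφ.1)))
          this.uncurry)
      exact h1.imp_trans (.of_thm (Thm.fs1 φ D hφ.1 hD.1))

/-- The witness `c` may have entered the interpolants after place `j`, so the tail starting from `B
∧ φ(c)` is first projected to one starting from a sentence `F` without `c`. Since `c` is foreign to
`B` and `F`, `∃x φ` then yields `B → F`. -/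
theorem of_addAt_subst {x : ℕ} {c : σ.Const} (hex : ex x φ ∈ Δ j)
    (hΔ : ∀ i, ∀ γ ∈ Δ i, ¬ γ.HasConst c) (hN : ∀ E ∈ N, ¬ E.HasConst c)
    (hs : (ex x φ).IsSentence) (hc : c ∉ constsBelow C j)
    (h : Refutes C n N (addAt Δ j (φ.subst x c)) 0 top) : Refutes C n N Δ 0 top := by
  have hφ : (φ.subst x c).IsSentence := (isSentence_ex.1 hs).isSentence_subst
  refine h.propagate (j := j) (fun m hm => addAt_of_ne (by omega)) fun B hB hR => ?_
  have hR := hR.of_addAt_self hφ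
  obtain ⟨F, hF⟩ := exists_isProjection_singleton c hR.isSentence
  have hR' : Refutes C n N Δ j F := hR.projection (S := {c})
    (fun i γ hγ d hd => hd ▸ hΔ i γ hγ) (fun E hE d hd => hd ▸ hN E hE) hF
  refine hR'.of_imp ((Proves.of_mem hs hex).mp_thm ?_)
  refine Thm.ex_imp (hΔ j (ex x φ) hex) (fun h => ?_) hF.imp.curry.swap
  rcases h with h | h
  · exact hc (hB.2 c h)
  · exact (hF.mem.2 c h).2 rfl

end Refutes

/-- Chains of prime saturated theories in the languages with constants `C i`, consecutive members
of which are related by the canonical modal accessibility relation. -/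
structure PrimeChain (C : ℕ → Set σ.Const) (n : ℕ) (Γ : ℕ → Set (Formula σ)) : Prop where
  sub : ∀ i ≤ n, Γ i ⊆ sentences (C i)
  closed : ∀ i ≤ n, ∀ φ ∈ sentences (C i), Proves (Γ i) φ → φ ∈ Γ i
  bot_notMem : ∀ i ≤ n, bot ∉ Γ i
  prime : ∀ i ≤ n, ∀ φ ψ, φ.or ψ ∈ Γ i → φ ∈ Γ i ∨ ψ ∈ Γ i
  witness : ∀ i ≤ n, ∀ x φ, ex x φ ∈ Γ i → ∃ c ∈ C i, φ.subst x c ∈ Γ i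
  box : ∀ i < n, ∀ φ, box φ ∈ Γ i → φ ∈ Γ (i + 1)
  dia : ∀ i < n, ∀ φ ∈ sentences (C i), φ ∈ Γ (i + 1) → dia φ ∈ Γ i
  eq_empty : ∀ i, n < i → Γ i = ∅

/-! ### The Lindenbaum construction for whole chains -/

section Lindenbaum

variable {C : ℕ → Set σ.Const} {n : ℕ} {N : Set (Formula σ)}

/-- The constants of the `i`-th language that are not used in the lower languages, in `Δ` and
in `N`. -/
def freshConsts (C : ℕ → Set σ.Const) (N : Set (Formula σ)) (Δ : ℕ → Set (Formula σ)) (i : ℕ) :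
    Set σ.Const :=
  {c | c ∈ C i ∧ c ∉ constsBelow C i ∧ (∀ j, ∀ γ ∈ Δ j, ¬ γ.HasConst c) ∧
    ∀ E ∈ N, ¬ E.HasConst c}

/-- Consistent chains of theories that leave infinitely many constants unused. -/
structure Extendible (C : ℕ → Set σ.Const) (n : ℕ) (N : Set (Formula σ))
    (Δ : ℕ → Set (Formula σ)) : Prop where
  sub : ∀ i ≤ n, Δ i ⊆ sentences (C i)
  not_refutes : ¬ Refutes C n N Δ 0 top
  infinite_fresh : ∀ i ≤ n, (freshConsts C N Δ i).Infinite

theorem Extendible.addAt {Δ : ℕ → Set (Formula σ)} (h : Extendible C n N Δ) {j : ℕ}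
    {φ : Formula σ} (hφ : φ ∈ sentences (C j)) (hR : ¬ Refutes C n N (addAt Δ j φ) 0 top) :
    Extendible C n N (addAt Δ j φ) where
  sub i hi := by
    intro ψ hψ
    rcases mem_addAt.1 hψ with ⟨rfl, rfl⟩ | hψ
    · exact hφ
    · exact h.sub i hi hψ
  not_refutes := hR
  infinite_fresh i hi := by
    refine ((h.infinite_fresh i hi).sdiff (finite_hasConst φ)).mono ?_
    rintro c ⟨⟨h1, h2, h3, h4⟩, h5⟩
    refine ⟨h1, h2, fun k γ hγ => ?_, h4⟩
    rcases mem_addAt.1 hγ with ⟨-, rfl⟩ | hγ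
    · exact h5
    · exact h3 k γ hγ

/-- An admissible formula is added at the given place, an existential one together with a witness.
The test is made on `Δ`; stating it for `Δ'` loses nothing in the limit, where the chain is larger
still. -/
theorem Extendible.exists_next {Δ : ℕ → Set (Formula σ)} (h : Extendible C n N Δ)
    (p : ℕ × Formula σ) : ∃ Δ', Extendible C n N Δ' ∧ Δ ≤ Δ' ∧
      (p.1 ≤ n → p.2 ∈ sentences (C p.1) → ¬ Refutes C n N (FOFS.addAt Δ' p.1 p.2) 0 top →
        p.2 ∈ Δ' p.1 ∧ ∀ x φ, p.2 = ex x φ → ∃ c ∈ C p.1, φ.subst x c ∈ Δ' p.1) := by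
  obtain ⟨j, φ⟩ := p
  by_cases hp : j ≤ n ∧ φ ∈ sentences (C j) ∧ ¬ Refutes C n N (FOFS.addAt Δ j φ) 0 top
  · obtain ⟨hj, hφ, hR⟩ := hp
    have h1 := h.addAt hφ hR
    have hmem : φ ∈ FOFS.addAt Δ j φ j := mem_addAt.2 (Or.inl ⟨rfl, rfl⟩)
    by_cases hex : ∃ x θ, φ = ex x θ
    · obtain ⟨x, θ, rfl⟩ := hex
      obtain ⟨c, hc⟩ := (h1.infinite_fresh j hj).nonempty
      have hsub : θ.subst x c ∈ sentences (C j) := subst_mem_sentences (φ := θ) (x := x) hφ hc.1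
      have hR' : ¬ Refutes C n N (FOFS.addAt (FOFS.addAt Δ j (ex x θ)) j (θ.subst x c)) 0 top :=
        fun hR' => h1.not_refutes
          (hR'.of_addAt_subst hmem hc.2.2.1 hc.2.2.2 hφ.1 hc.2.1)
      refine ⟨_, h1.addAt hsub hR', (le_addAt _ _ _).trans (le_addAt _ _ _), fun _ _ _ => ⟨?_, ?_⟩⟩
      · exact mem_addAt.2 (Or.inr hmem)
      · rintro x' θ' e
        obtain ⟨rfl, rfl⟩ : x = x' ∧ θ = θ' := by simpa using e
        exact ⟨c, hc.1, mem_addAt.2 (Or.inl ⟨rfl, rfl⟩)⟩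
    · refine ⟨_, h1, le_addAt _ _ _, fun _ _ _ => ⟨hmem, fun x θ e => (hex ⟨x, θ, e⟩).elim⟩⟩
  · exact ⟨Δ, h, le_rfl, fun h1 h2 h3 => (hp ⟨h1, h2, h3⟩).elim⟩

theorem Extendible.exists_maximal {Δ : ℕ → Set (Formula σ)} (h : Extendible C n N Δ) :
    ∃ Γ : ℕ → Set (Formula σ), Δ ≤ Γ ∧ (∀ i ≤ n, Γ i ⊆ sentences (C i)) ∧
      ¬ Refutes C n N Γ 0 top ∧
      (∀ i ≤ n, ∀ φ ∈ sentences (C i), ¬ Refutes C n N (FOFS.addAt Γ i φ) 0 top → φ ∈ Γ i) ∧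
      ∀ i ≤ n, ∀ x φ, ex x φ ∈ Γ i → ∃ c ∈ C i, φ.subst x c ∈ Γ i := by
  have : Nonempty (ℕ × Formula σ) := ⟨(0, bot)⟩
  obtain ⟨e, he⟩ := exists_surjective_nat (ℕ × Formula σ)
  choose next hnext using fun (Δ : {Δ // Extendible C n N Δ}) => Δ.2.exists_next
  let seq : ℕ → {Δ // Extendible C n N Δ} := fun k =>
    Nat.rec ⟨Δ, h⟩ (fun k Δ' => ⟨next Δ' (e k), (hnext Δ' (e k)).1⟩) k
  let T : ℕ → ℕ → Set (Formula σ) := fun k => (seq k).1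
  have hT : Monotone T := monotone_nat_of_le_succ fun k => (hnext (seq k) (e k)).2.1
  let Γ : ℕ → Set (Formula σ) := fun i => ⋃ k, T k i
  have hTΓ : ∀ k, T k ≤ Γ := fun k i => Set.subset_iUnion (fun k => T k i) k
  have hR : ¬ Refutes C n N Γ 0 top := fun hR => by
    obtain ⟨k, hk⟩ := Refutes.exists_of_iUnion hT hR
    exact (seq k).2.not_refutes hk
  have hsub : ∀ i ≤ n, Γ i ⊆ sentences (C i) :=
    fun i hi => Set.iUnion_subset fun k => (seq k).2.sub i hi
  have hmax : ∀ i ≤ n, ∀ φ ∈ sentences (C i), ¬ Refutes C n N (FOFS.addAt Γ i φ) 0 top →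
      φ ∈ Γ i ∧ ∀ x θ, φ = ex x θ → ∃ c ∈ C i, θ.subst x c ∈ Γ i := by
    intro i hi φ hφ hR
    obtain ⟨k, hk⟩ := he (i, φ)
    have h1 := (hnext (seq k) (e k)).2.2
    rw [hk] at h1
    have h2 : next (seq k) (i, φ) = T (k + 1) := by rw [← hk]
    obtain ⟨h3, h4⟩ := h1 hi hφ fun hR' => hR (hR'.mono (addAt_mono (h2.trans_le (hTΓ (k + 1)))))
    rw [h2] at h3 h4
    refine ⟨hTΓ (k + 1) i h3, fun x θ e => ?_⟩
    obtain ⟨c, hc, h5⟩ := h4 x θ e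
    exact ⟨c, hc, hTΓ (k + 1) i h5⟩
  refine ⟨Γ, hTΓ 0, hsub, hR, fun i hi φ hφ h => (hmax i hi φ hφ h).1, fun i hi x φ hφ => ?_⟩
  -- Adding a member again changes nothing, so it passes the test and received its witness when it
  -- was enumerated.
  exact (hmax i hi _ (hsub i hi hφ) fun h => hR (h.mono (addAt_le le_rfl hφ))).2 x φ rfl

/-- Consistent chains extend to chains of prime saturated theories. -/
theorem Extendible.exists_primeChain (hC : Monotone C) (hN : ImpDirected N)
    (hNs : ∀ E ∈ N, E.IsSentence) (hne : N.Nonempty) {Δ : ℕ → Set (Formula σ)}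
    (h : Extendible C n N Δ) :
    ∃ Γ, PrimeChain C n Γ ∧ (∀ i ≤ n, Δ i ⊆ Γ i) ∧ ∀ E ∈ N, E ∉ Γ n := by
  obtain ⟨Γ, hΔ, hsub, hR, hmax, hwit⟩ := h.exists_maximal
  have hclosed : ∀ i ≤ n, ∀ φ ∈ sentences (C i), Proves (Γ i) φ → φ ∈ Γ i :=
    fun i hi φ hφ hp => hmax i hi φ hφ fun h => hR (h.of_addAt_proves hp)
  -- An inconsistent place would pass `⊥` on, through `□⊥`, to every later place, and the last one
  -- would prove a member of `N`.
  have hbot : ∀ d i, i + d = n → bot ∈ Γ i → Refutes C n N Γ i top := by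
    intro d i hd hb
    have hb' : Proves (Γ i) bot := .of_mem rfl hb
    obtain ⟨E, hE⟩ := hne
    induction d generalizing i with
    | zero =>
      obtain rfl : i = n := by omega
      exact .base hE ((hb'.mp_thm (Thm.exfalso (hNs E hE))).imp_of rfl)
    | succ d ih =>
      have hbox : box bot ∈ Γ i := hclosed i (by omega) _ bot_mem_sentences
        (hb'.mp_thm (Thm.exfalso rfl))
      have hb1 : bot ∈ Γ (i + 1) := hmax (i + 1) (by omega) _ bot_mem_sentences
        fun h => hR (h.of_addAt_box bot_mem_sentences hbox)
      exact .step top_mem_sentences (ih (i + 1) (by omega) hb1 (.of_mem rfl hb1))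
        (.of_thm (Thm.imp_of rfl Thm.box_top))
  -- The places beyond `n` are unconstrained so far; emptying them lets histories be compared
  -- pointwise at all indices.
  refine ⟨fun i => if i ≤ n then Γ i else ∅, ⟨?_, ?_, ?_, ?_, ?_, ?_, ?_, ?_⟩, ?_, ?_⟩
  · intro i hi
    simpa only [hi, if_true] using hsub i hi
  · intro i hi
    simpa only [hi, if_true] using hclosed i hi
  · intro i hi
    simp only [hi, if_true]
    exact fun hb => hR (hbot (n - i) i (by omega) hb).top_zero
  · intro i hi φ ψ
    simp only [hi, if_true]
    intro hor
    have hs := hsub i hi hor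
    by_contra! hcon
    have h1 := fun h => hcon.1 (hmax i hi φ (or_mem_sentences.1 hs).1 h)
    have h2 := fun h => hcon.2 (hmax i hi ψ (or_mem_sentences.1 hs).2 h)
    rw [imp_false, not_not] at h1 h2
    exact hR (Refutes.of_addAt_or hN hor hs.1 h1 h2)
  · intro i hi x φ
    simpa only [hi, if_true] using hwit i hi x φ
  · intro i hi φ
    simp only [hi.le, Nat.succ_le_of_lt hi, if_true]
    intro hbox
    have hφ : φ ∈ sentences (C i) := box_mem_sentences.1 (hsub i hi.le hbox)
    exact hmax (i + 1) hi _ (sentences_mono (hC (Nat.le_succ i)) hφ)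
      fun h => hR (h.of_addAt_box hφ hbox)
  · intro i hi φ hφ
    simp only [hi.le, Nat.succ_le_of_lt hi, if_true]
    exact fun hmem => hmax i hi.le _ hφ fun h => hR (h.of_addAt_dia hi hφ hmem)
  · intro i hi
    simp [Nat.not_le.2 hi]
  · intro i hi
    simpa only [hi, if_true] using hΔ i
  · intro E hE
    simp only [le_rfl, if_true]
    intro hmem
    exact hR (Refutes.top_zero (.base hE ((Proves.of_mem (hNs E hE) hmem).imp_of rfl)))

end Lindenbaum

open Formula

/-! ## The canonical model -/

namespace PrimeChain

variable {C : ℕ → Set σ.Const} {n : ℕ} {Γ : ℕ → Set (Formula σ)} {i : ℕ} {φ ψ : Formula σ}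

theorem proves (h : PrimeChain C n Γ) (hi : i ≤ n) (hφ : φ ∈ Γ i) : Proves (Γ i) φ :=
  .of_mem (h.sub i hi hφ).1 hφ

theorem and_mem (h : PrimeChain C n Γ) (hi : i ≤ n) : φ.and ψ ∈ Γ i ↔ φ ∈ Γ i ∧ ψ ∈ Γ i := by
  constructor
  · intro hm
    have hs := and_mem_sentences.1 (h.sub i hi hm)
    exact ⟨h.closed i hi _ hs.1 (h.proves hi hm).and_left,
      h.closed i hi _ hs.2 (h.proves hi hm).and_right⟩
  · rintro ⟨h1, h2⟩
    exact h.closed i hi _ (and_mem_sentences.2 ⟨h.sub i hi h1, h.sub i hi h2⟩)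
      ((h.proves hi h1).and_intro (h.proves hi h2))

theorem conj_mem (h : PrimeChain C n Γ) (hi : i ≤ n) {L : List (Formula σ)}
    (hL : ∀ γ ∈ L, γ ∈ Γ i) : conj L ∈ Γ i := by
  induction L with
  | nil => exact h.closed i hi _ top_mem_sentences (.of_thm Thm.top)
  | cons φ L ih =>
    simp only [List.mem_cons, forall_eq_or_imp] at hL
    exact (h.and_mem hi).2 ⟨hL.1, ih hL.2⟩

theorem box_conj_mem (h : PrimeChain C n Γ) (hi : i ≤ n) {L : List (Formula σ)}
    (hL : ∀ γ ∈ L, Formula.box γ ∈ Γ i) : Formula.box (conj L) ∈ Γ i := by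
  induction L with
  | nil => exact h.closed i hi _ (box_mem_sentences.2 top_mem_sentences) (.of_thm Thm.box_top)
  | cons φ L ih =>
    simp only [List.mem_cons, forall_eq_or_imp] at hL
    have h1 := hL.1
    have h2 := ih hL.2
    exact h.closed i hi _ (box_mem_sentences.2 (and_mem_sentences.2
      ⟨box_mem_sentences.1 (h.sub i hi h1), box_mem_sentences.1 (h.sub i hi h2)⟩))
      ((h.proves hi h1).box_and (h.proves hi h2))

theorem truncate (h : PrimeChain C n Γ) {m : ℕ} (hm : m ≤ n) :
    PrimeChain C m fun i => if i ≤ m then Γ i else ∅ where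
  sub i hi := by simpa only [hi, if_true] using h.sub i (hi.trans hm)
  closed i hi := by simpa only [hi, if_true] using h.closed i (hi.trans hm)
  bot_notMem i hi := by simpa only [hi, if_true] using h.bot_notMem i (hi.trans hm)
  prime i hi := by simpa only [hi, if_true] using h.prime i (hi.trans hm)
  witness i hi := by simpa only [hi, if_true] using h.witness i (hi.trans hm)
  box i hi := by
    simpa only [hi.le, Nat.succ_le_of_lt hi, if_true] using h.box i (hi.trans_le hm)
  dia i hi := by
    simpa only [hi.le, Nat.succ_le_of_lt hi, if_true] using h.dia i (hi.trans_le hm)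
  eq_empty i hi := by simp [Nat.not_le.2 hi]

theorem snoc (h : PrimeChain C n Γ) {Δ : ℕ → Set (Formula σ)}
    (hΔ : PrimeChain (fun _ => C (n + 1)) 0 Δ) (hbox : ∀ φ, Formula.box φ ∈ Γ n → φ ∈ Δ 0)
    (hdia : ∀ φ ∈ sentences (C n), φ ∈ Δ 0 → Formula.dia φ ∈ Γ n) :
    PrimeChain C (n + 1) (Function.update Γ (n + 1) (Δ 0)) := by
  have hself : Function.update Γ (n + 1) (Δ 0) (n + 1) = Δ 0 := Function.update_self ..
  have hne : ∀ i ≤ n, Function.update Γ (n + 1) (Δ 0) i = Γ i :=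
    fun i hi => Function.update_of_ne (by omega) ..
  refine ⟨?_, ?_, ?_, ?_, ?_, ?_, ?_, ?_⟩
  · intro i hi
    rcases Nat.le_succ_iff.1 hi with hi | rfl
    · rw [hne i hi]; exact h.sub i hi
    · rw [hself]; exact hΔ.sub 0 le_rfl
  · intro i hi
    rcases Nat.le_succ_iff.1 hi with hi | rfl
    · rw [hne i hi]; exact h.closed i hi
    · rw [hself]; exact hΔ.closed 0 le_rfl
  · intro i hi
    rcases Nat.le_succ_iff.1 hi with hi | rfl
    · rw [hne i hi]; exact h.bot_notMem i hi
    · rw [hself]; exact hΔ.bot_notMem 0 le_rfl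
  · intro i hi
    rcases Nat.le_succ_iff.1 hi with hi | rfl
    · rw [hne i hi]; exact h.prime i hi
    · rw [hself]; exact hΔ.prime 0 le_rfl
  · intro i hi
    rcases Nat.le_succ_iff.1 hi with hi | rfl
    · rw [hne i hi]; exact h.witness i hi
    · rw [hself]; exact hΔ.witness 0 le_rfl
  · intro i hi
    rcases Nat.lt_succ_iff_lt_or_eq.1 hi with hi | rfl
    · rw [hne i hi.le, hne (i + 1) hi]; exact h.box i hi
    · rw [hne i le_rfl, hself]; exact hbox
  · intro i hi
    rcases Nat.lt_succ_iff_lt_or_eq.1 hi with hi | rfl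
    · rw [hne i hi.le, hne (i + 1) hi]; exact h.dia i hi
    · rw [hne i le_rfl, hself]; exact hdia
  · intro i hi
    rw [Function.update_of_ne (by omega)]
    exact h.eq_empty i (by omega)

end PrimeChain

/-! ### Supply of constants and worlds -/

/-- A partition of the constants into infinite sets indexed by levels and stages, and an embedding
of the constants into the first of these sets. -/
structure Stratification (σ : Signature.{u}) where
  level : σ.Const → ℕ
  stage : σ.Const → ℕ
  infinite_fiber : ∀ i s, {c | level c = i ∧ stage c = s}.Infinite
  emb : σ.Const → σ.Const
  emb_injective : Function.Injective emb
  level_emb : ∀ c, level (emb c) = 0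
  stage_emb : ∀ c, stage (emb c) = 0

theorem nonempty_stratification (σ : Signature.{u}) : Nonempty (Stratification σ) := by
  have := σ.countable_const
  have := σ.infinite_const
  obtain ⟨e⟩ : Nonempty (σ.Const ≃ ℕ × ℕ × ℕ) := nonempty_equiv_of_countable
  -- Constants are identified with triples of numbers: level, stage, index. The embedding packs a
  -- whole triple into the index of level 0 and stage 0.
  refine ⟨⟨fun c => (e c).1, fun c => (e c).2.1, fun i s => ?_,
    fun c => e.symm (0, 0, Nat.pair (e c).1 (Nat.pair (e c).2.1 (e c).2.2)), fun c d h => ?_,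
    fun c => by simp, fun c => by simp⟩⟩
  · refine (Set.infinite_range_of_injective (f := fun k : ℕ => e.symm (i, s, k)) ?_).mono ?_
    · intro a b h
      simpa using h
    · rintro _ ⟨k, rfl⟩
      simp
  · have h' : Nat.pair (e c).1 (Nat.pair (e c).2.1 (e c).2.2) =
        Nat.pair (e d).1 (Nat.pair (e d).2.1 (e d).2.2) := by simpa using h
    rw [Nat.pair_eq_pair, Nat.pair_eq_pair] at h'
    exact e.injective (Prod.ext h'.1 (Prod.ext h'.2.1 h'.2.2))

namespace Stratification

variable (S : Stratification σ)

/-- The constants available at the given stage and level. -/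
def consts (s i : ℕ) : Set σ.Const := {c | S.level c ≤ i ∧ S.stage c ≤ s}

theorem consts_mono {s s' i i' : ℕ} (hs : s ≤ s') (hi : i ≤ i') :
    S.consts s i ⊆ S.consts s' i' :=
  fun _ hc => ⟨hc.1.trans hi, hc.2.trans hs⟩

theorem monotone_consts (s : ℕ) : Monotone (S.consts s) := fun _ _ h => S.consts_mono le_rfl h

theorem emb_mem_consts (c : σ.Const) (s i : ℕ) : S.emb c ∈ S.consts s i :=
  ⟨(S.level_emb c).le.trans (Nat.zero_le _), (S.stage_emb c).le.trans (Nat.zero_le _)⟩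

theorem notMem_constsBelow {s i : ℕ} {c : σ.Const} (hc : S.level c = i) :
    c ∉ constsBelow (S.consts s) i := by
  intro h
  obtain ⟨j, hj, h⟩ := Set.mem_iUnion₂.1 h
  exact absurd h.1 (by omega)

/-- The worlds of the canonical model: the history of a theory along the modal relation. -/
structure World where
  depth : ℕ
  stage : ℕ
  th : ℕ → Set (Formula σ)
  chain : PrimeChain (S.consts stage) depth th

namespace World

variable {S} {w v w' : S.World} {φ ψ : Formula σ}

/-- The theory of a world. -/
def thy (w : S.World) : Set (Formula σ) := w.th w.depth

/-- The domain of a world. -/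
def dom (w : S.World) : Set σ.Const := S.consts w.stage w.depth

/-- Distinct comparable worlds differ strictly in stage. This leaves the constants of the larger
world's stage unused by the smaller one and by its modal successors, as `exists_le_of_M` requires.
-/
instance : PartialOrder S.World where
  le w w' := w = w' ∨ (w.depth = w'.depth ∧ w.stage < w'.stage ∧ w.th ≤ w'.th)
  le_refl w := Or.inl rfl
  le_trans w w' w'' := by
    rintro (rfl | ⟨h1, h2, h3⟩) (rfl | ⟨h4, h5, h6⟩)
    · exact Or.inl rfl
    · exact Or.inr ⟨h4, h5, h6⟩
    · exact Or.inr ⟨h1, h2, h3⟩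
    · exact Or.inr ⟨h1.trans h4, h2.trans h5, h3.trans h6⟩
  le_antisymm w w' := by
    rintro (rfl | ⟨-, h2, -⟩) (h | ⟨-, h5, -⟩)
    · rfl
    · rfl
    · exact h.symm
    · omega

theorem thy_subset (h : w ≤ w') : w.thy ⊆ w'.thy := by
  rcases h with rfl | ⟨h1, -, h3⟩
  · exact subset_rfl
  · rw [thy, thy, ← h1]
    exact h3 _

theorem dom_subset (h : w ≤ w') : w.dom ⊆ w'.dom := by
  rcases h with rfl | ⟨h1, h2, -⟩
  · exact subset_rfl
  · exact S.consts_mono h2.le h1.le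

/-- The modal relation: adding one theory at the end of the history. -/
def M (w v : S.World) : Prop :=
  v.depth = w.depth + 1 ∧ v.stage = w.stage ∧ ∀ i ≤ w.depth, v.th i = w.th i

theorem thy_sub (w : S.World) : w.thy ⊆ sentences w.dom := w.chain.sub _ le_rfl

theorem mem_of_proves (hφ : φ ∈ sentences w.dom) (h : Proves w.thy φ) : φ ∈ w.thy :=
  w.chain.closed _ le_rfl φ hφ h

theorem proves (h : φ ∈ w.thy) : Proves w.thy φ := w.chain.proves le_rfl h

theorem mp (h : φ.imp ψ ∈ w.thy) (h' : φ ∈ w.thy) : ψ ∈ w.thy :=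
  mem_of_proves (imp_mem_sentences.1 (w.thy_sub h)).2 ((proves h).mp (proves h'))

theorem M.dom_subset (h : w.M v) : w.dom ⊆ v.dom :=
  S.consts_mono h.2.1.ge (by rw [h.1]; omega)

theorem M.mem_of_box (h : w.M v) (hφ : box φ ∈ w.thy) : φ ∈ v.thy := by
  rw [thy, h.1]
  refine v.chain.box _ (by rw [h.1]; omega) φ ?_
  rwa [h.2.2 _ le_rfl]

theorem M.dia_mem (h : w.M v) (hφ : φ ∈ sentences w.dom) (hv : φ ∈ v.thy) : dia φ ∈ w.thy := by
  rw [thy, ← h.2.2 _ le_rfl]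
  refine v.chain.dia _ (by rw [h.1]; omega) φ ?_ ?_
  · rw [h.2.1]; exact hφ
  · rwa [← h.1]

/-- The history without its last theory. -/
def truncate (v : S.World) (m : ℕ) (hm : m ≤ v.depth) : S.World :=
  ⟨m, v.stage, fun i => if i ≤ m then v.th i else ∅, v.chain.truncate hm⟩

theorem M_truncate (v : S.World) (m : ℕ) (hm : v.depth = m + 1) :
    (v.truncate m (by omega)).M v :=
  ⟨hm, rfl, fun i hi => by
    have hi : i ≤ m := hi
    simp [truncate, hi]⟩

theorem le_truncate {m : ℕ} (hm : m ≤ v.depth) (hd : w.depth = m) (hs : w.stage < v.stage)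
    (h : ∀ i ≤ m, w.th i ⊆ v.th i) : w ≤ v.truncate m hm := by
  refine Or.inr ⟨hd, hs, fun i => ?_⟩
  by_cases hi : i ≤ m
  · simpa [truncate, hi] using h i hi
  · rw [w.chain.eq_empty i (by omega)]
    exact Set.empty_subset _

/-- The condition `fc1`: `v'` already carries an enlarged copy of the history `w`, found by cutting
off its last theory. -/
theorem exists_M_of_le (h : w.M v) {v' : S.World} (hv : v ≤ v') :
    ∃ w', w ≤ w' ∧ w'.M v' := by
  rcases hv with rfl | ⟨h1, h2, h3⟩
  · exact ⟨w, le_rfl, h⟩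
  · have hd : v'.depth = w.depth + 1 := h1 ▸ h.1
    refine ⟨v'.truncate w.depth (by omega), le_truncate _ rfl (h.2.1 ▸ h2) fun i hi => ?_,
      M_truncate v' _ hd⟩
    rw [← h.2.2 i hi]
    exact h3 i

/-- Monotonicity of `◇` gives `◇(B → E)`, and the axiom `◇(B → E) → (□B → ◇E)` finishes. -/
theorem dia_mem_of_imp {γ B E : Formula σ} (hE : E ∈ sentences w.dom) (hγ : dia γ ∈ w.thy)
    (hB : box B ∈ w.thy) (h : Thm (γ.imp (B.imp E))) : dia E ∈ w.thy := by
  have hBs : B ∈ sentences w.dom := box_mem_sentences.1 (w.thy_sub hB)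
  refine mem_of_proves (dia_mem_sentences.2 hE) ?_
  exact (((proves hγ).mp_thm (Thm.reg_dia h)).mp_thm (Thm.fs2 B E hBs.1 hE.1)).mp (proves hB)

/-- The appended theory must contain `Θ` and every `χ` with `□χ` in `w`, and omit every `E` in the
language of `w` with `◇E` not in `w`. The last hypothesis says exactly that these demands are
compatible; `hfresh` reserves constants of the new level as witnesses. The construction is the
one-place case `n = 0` of the chain Lindenbaum lemma. -/
theorem exists_M (w : S.World) (Θ : Set (Formula σ))
    (hΘ : Θ ⊆ sentences (S.consts w.stage (w.depth + 1)))
    (hfresh : ∀ c, S.level c = w.depth + 1 → S.stage c = w.stage → ∀ γ ∈ Θ, ¬ γ.HasConst c)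
    (h : ∀ B E, E ∈ sentences w.dom → box B ∈ w.thy → Proves Θ (B.imp E) → dia E ∈ w.thy) :
    ∃ v, w.M v ∧ Θ ⊆ v.thy := by
  set N : Set (Formula σ) := {E | E ∈ sentences w.dom ∧ dia E ∉ w.thy} with hNdef
  set Ξ : Set (Formula σ) := {χ | box χ ∈ w.thy}
  have hΞ : Ξ ⊆ sentences w.dom := fun χ hχ => box_mem_sentences.1 (w.thy_sub hχ)
  have hsub : S.consts w.stage w.depth ⊆ S.consts w.stage (w.depth + 1) :=
    S.consts_mono le_rfl (Nat.le_succ _)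
  have hN : ImpDirected N := by
    rintro E ⟨hE, hE1⟩ E' ⟨hE', hE1'⟩
    refine ⟨E.or E', ⟨or_mem_sentences.2 ⟨hE, hE'⟩, fun hd => ?_⟩, Thm.or_left hE.1 hE'.1,
      Thm.or_right hE.1 hE'.1⟩
    have hor : (dia E).or (dia E') ∈ w.thy := mem_of_proves
      (or_mem_sentences.2 ⟨dia_mem_sentences.2 hE, dia_mem_sentences.2 hE'⟩)
      ((Proves.of_thm (Thm.dia_or E E' hE.1 hE'.1)).and_left.mp (proves hd))
    exact (w.chain.prime _ le_rfl _ _ hor).elim hE1 hE1'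
  have hbot : bot ∈ N := ⟨bot_mem_sentences, fun hd => w.chain.bot_notMem _ le_rfl
    (mem_of_proves bot_mem_sentences ((Proves.of_thm Thm.dia_bot).mp (proves hd)))⟩
  have hext : Extendible (fun _ => S.consts w.stage (w.depth + 1)) 0 N fun _ => Θ ∪ Ξ := by
    refine ⟨fun _ _ => Set.union_subset hΘ (hΞ.trans (sentences_mono hsub)), fun hR => ?_,
      fun i hi => ?_⟩
    · obtain ⟨E, ⟨hE, hdE⟩, hp⟩ := hR.exists_of_eq rfl
      obtain ⟨L, hL, hp⟩ := (hp.mp (.of_thm Thm.top)).exists_conj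
      exact hdE (h _ E hE (w.chain.box_conj_mem le_rfl hL) hp)
    · refine (S.infinite_fiber (w.depth + 1) w.stage).mono ?_
      rintro c ⟨h1, h2⟩
      have hdom : c ∉ w.dom := fun hc => absurd hc.1 (by omega)
      refine ⟨⟨h1.le, h2.le⟩, ?_, ?_, fun E hE hc => hdom (hE.1.2 c hc)⟩
      · obtain rfl : i = 0 := by omega
        simp [constsBelow]
      · rintro - γ (hγ | hγ)
        · exact hfresh c h1 h2 γ hγ
        · exact fun hc => hdom ((hΞ hγ).2 c hc)
  obtain ⟨Γ, hΓ, hsubΓ, hNΓ⟩ := hext.exists_primeChain (fun _ _ _ => le_rfl) hN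
    (fun E hE => hE.1.1) ⟨bot, hbot⟩
  have hsub0 := hsubΓ 0 le_rfl
  refine ⟨⟨w.depth + 1, w.stage, _, w.chain.snoc hΓ (fun φ hφ => hsub0 (Or.inr hφ))
    fun φ hφ hmem => ?_⟩, ⟨rfl, rfl, fun i hi => Function.update_of_ne (by omega) ..⟩, ?_⟩
  · by_contra hcon
    exact hNΓ φ ⟨hφ, hcon⟩ hmem
  · simp only [thy, Function.update_self]
    exact fun φ hφ => hsub0 (Or.inl hφ)

theorem exists_M_of_dia (h : dia φ ∈ w.thy) : ∃ v, w.M v ∧ φ ∈ v.thy := by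
  have hφ : φ ∈ sentences w.dom := dia_mem_sentences.1 (w.thy_sub h)
  obtain ⟨v, hv, hsub⟩ := exists_M w {φ}
    (Set.singleton_subset_iff.2 (sentences_mono (S.consts_mono le_rfl (Nat.le_succ _)) hφ))
    (fun c hc _ γ hγ hc' => by
      rw [Set.mem_singleton_iff.1 hγ] at hc'
      exact absurd (hφ.2 c hc').1 (by omega))
    (fun B E hE hB hp => by
      have hp : Proves (insert φ ∅) (B.imp E) := by simpa using hp
      exact dia_mem_of_imp hE h hB (hp.intro hφ.1).thm)
  exact ⟨v, hv, hsub rfl⟩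

/-- The condition `fc2`: the theory of `v` is kept and completed to a modal successor of `w'`. -/
theorem exists_le_of_M (h : w.M v) (hw : w ≤ w') : ∃ v', v ≤ v' ∧ w'.M v' := by
  rcases hw with rfl | ⟨h1, h2, h3⟩
  · exact ⟨v, le_rfl, h⟩
  have hsub := v.thy_sub
  rw [dom, h.1, h.2.1] at hsub
  obtain ⟨v', hv', hΘ⟩ := exists_M w' v.thy
    (hsub.trans (sentences_mono (S.consts_mono h2.le (by omega))))
    (fun c _ hc γ hγ hc' => absurd ((hsub hγ).2 c hc').2 (by omega))
    (fun B E hE hB hp => by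
      obtain ⟨L, hL, hp⟩ := hp
      have hB' : B ∈ sentences w'.dom := box_mem_sentences.1 (w'.thy_sub hB)
      have hLmem : conj L ∈ v.thy := v.chain.conj_mem le_rfl hL
      -- Quantifying out the constants of the new level brings the used part of `v` into the
      -- language of `w`, so its diamond lies in `w` and hence in `w'`. Both `B` and `E` avoid that
      -- level, so the implication survives.
      obtain ⟨γ, hγ⟩ := exists_isProjection {c | S.level c = w.depth + 1} (hsub hLmem).1
      have hγw : γ ∈ sentences w.dom := ⟨hγ.mem.1, fun c hc => by
        obtain ⟨h4, h5⟩ := hγ.mem.2 c hc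
        have h6 := (hsub hLmem).2 c h4
        have h7 : S.level c ≠ w.depth + 1 := h5
        exact ⟨by have := h6.1; omega, h6.2⟩⟩
      have hγv : γ ∈ v.thy := mem_of_proves (sentences_mono h.dom_subset hγw)
        ((proves hLmem).mp_thm hγ.imp)
      refine dia_mem_of_imp hE (thy_subset (Or.inr ⟨h1, h2, h3⟩) (h.dia_mem hγw hγv)) hB
        (hγ.elim ∅ _ (by simp) (fun c hc hc' => ?_) (.of_thm hp)).thm
      have h8 : S.level c = w.depth + 1 := hc
      exact absurd ((imp_mem_sentences.2 ⟨hB', hE⟩).2 c hc').1 (by omega))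
  refine ⟨v', Or.inr ⟨by rw [h.1, hv'.1, h1], by rw [h.2.1, hv'.2.1]; exact h2, fun i => ?_⟩, hv'⟩
  rcases lt_trichotomy i (w.depth + 1) with hi | rfl | hi
  · rw [h.2.2 i (by omega), hv'.2.2 i (by omega)]
    exact h3 i
  · have e : v.th (w.depth + 1) = v.thy := by rw [thy, h.1]
    have e' : v'.th (w.depth + 1) = v'.thy := by rw [thy, hv'.1, h1]
    rw [e, e']
    exact hΘ
  · rw [v.chain.eq_empty i (by rw [h.1]; exact hi)]
    exact Set.empty_subset _

/-! ### Enlarging a whole history -/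

theorem impDirected_singleton (hφ : φ.IsSentence) : ImpDirected {φ} := by
  rintro E rfl E' rfl
  exact ⟨E', rfl, Thm.imp_self hφ, Thm.imp_self hφ⟩

/-- Excluding refutations that start at the last theory of `w` is enough, because any refutation can
be pushed along the history to one that starts there. The condition on the constants of `ψ` allows
new constants of level `w.depth`, as the case of `∀` needs. -/
theorem exists_extension (w : S.World) {m : ℕ} (hm : w.depth ≤ m) (hφ : φ ∈ sentences w.dom)
    (hψ : ψ.IsSentence) (hψc : ∀ c, ψ.HasConst c → S.stage c ≤ w.stage ∨ w.depth ≤ S.level c)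
    (h : ∀ B ∈ w.thy,
      ¬ Refutes (S.consts (w.stage + 1)) m {ψ} (addAt w.th w.depth φ) w.depth B) :
    ∃ w' : S.World, w'.depth = m ∧ w'.stage = w.stage + 1 ∧ (∀ i ≤ m, w.th i ⊆ w'.th i) ∧
      φ ∈ w'.th w.depth ∧ ψ ∉ w'.thy := by
  have hstage : ∀ j, ∀ γ ∈ addAt w.th w.depth φ j, ∀ c, γ.HasConst c → S.stage c ≤ w.stage := by
    intro j γ hγ c hc
    rcases mem_addAt.1 hγ with ⟨-, rfl⟩ | hγ
    · exact (hφ.2 c hc).2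
    · by_cases hj : j ≤ w.depth
      · exact ((w.chain.sub j hj hγ).2 c hc).2
      · rw [w.chain.eq_empty j (by omega)] at hγ
        exact hγ.elim
  have key : ∀ d i, i + d = w.depth → ∀ B ∈ w.th i,
      ¬ Refutes (S.consts (w.stage + 1)) m {ψ} (addAt w.th w.depth φ) i B := by
    intro d
    induction d with
    | zero =>
      rintro i hi B hB
      obtain rfl : i = w.depth := hi
      exact h B hB
    | succ d ih =>
      intro i hi B hB hR
      obtain ⟨D, hD, hR, hp⟩ := hR.exists_of_lt (by omega)
      rw [addAt_of_ne (by omega)] at hp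
      -- The interpolant may use constants of the new stage, foreign to `w`. Once they are projected
      -- out, `□D'` belongs to the `i`-th theory, so `D'` belongs to the next one and starts a
      -- shorter refutation there.
      obtain ⟨D', hD'⟩ := exists_isProjection {c | S.stage c = w.stage + 1 ∧ S.level c ≤ i} hD.1
      have hR' := hR.projection (fun j γ hγ c hc hc' => absurd (hstage j γ hγ c hc')
        (by have := hc.1; omega)) (fun E hE c hc hc' => by
          rw [Set.mem_singleton_iff.1 hE] at hc'
          have h1 := hc.1
          have h2 := hc.2
          have h3 := hψc c hc'
          omega) hD'
      have hDs : D' ∈ sentences (S.consts w.stage i) := ⟨hD'.mem.1, fun c hc => by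
        obtain ⟨h1, h2⟩ := hD'.mem.2 c hc
        obtain ⟨h3, h4⟩ := hD.2 c h1
        have h5 : ¬ (S.stage c = w.stage + 1 ∧ S.level c ≤ i) := h2
        exact ⟨h3, by omega⟩⟩
      refine ih (i + 1) (by omega) D' (w.chain.box i (by omega) D' ?_) hR'
      exact w.chain.closed i (by omega) _ (box_mem_sentences.2 hDs)
        ((hp.mp (w.chain.proves (by omega) hB)).box_mono hD'.imp)
  have hext : Extendible (S.consts (w.stage + 1)) m {ψ} (addAt w.th w.depth φ) := by
    refine ⟨fun i hi γ hγ => ?_, ?_, fun i hi => ?_⟩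
    · rcases mem_addAt.1 hγ with ⟨rfl, rfl⟩ | hγ
      · exact sentences_mono (S.consts_mono (Nat.le_succ _) le_rfl) hφ
      · by_cases hj : i ≤ w.depth
        · exact sentences_mono (S.consts_mono (Nat.le_succ _) le_rfl) (w.chain.sub i hj hγ)
        · rw [w.chain.eq_empty i (by omega)] at hγ
          exact hγ.elim
    · exact key w.depth 0 (by omega) top
        (w.chain.closed 0 (by omega) _ top_mem_sentences (.of_thm Thm.top))
    · refine ((S.infinite_fiber i (w.stage + 1)).sdiff (finite_hasConst ψ)).mono ?_
      rintro c ⟨⟨h1, h2⟩, h3⟩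
      refine ⟨⟨h1.le, h2.le⟩, S.notMem_constsBelow h1, fun j γ hγ hc => ?_, ?_⟩
      · exact absurd (hstage j γ hγ c hc) (by omega)
      · rintro E rfl
        exact h3
  obtain ⟨Γ, hΓ, hsub, hN⟩ := hext.exists_primeChain (S.monotone_consts _)
    (impDirected_singleton hψ)
    (by rintro E rfl; exact hψ) ⟨ψ, rfl⟩
  exact ⟨⟨m, w.stage + 1, Γ, hΓ⟩, rfl, rfl,
    fun i hi => (le_addAt _ _ _ i).trans (hsub i hi),
    hsub _ hm (mem_addAt.2 (Or.inl ⟨rfl, rfl⟩)), hN ψ rfl⟩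

theorem le_of_exists_extension (hd : w'.depth = w.depth) (hs : w'.stage = w.stage + 1)
    (h : ∀ i ≤ w.depth, w.th i ⊆ w'.th i) : w ≤ w' := by
  refine Or.inr ⟨hd.symm, by omega, fun i => ?_⟩
  by_cases hi : i ≤ w.depth
  · exact h i hi
  · rw [w.chain.eq_empty i (by omega)]
    exact Set.empty_subset _

theorem exists_le_of_imp_notMem (hs : φ.imp ψ ∈ sentences w.dom) (h : φ.imp ψ ∉ w.thy) :
    ∃ w', w ≤ w' ∧ φ ∈ w'.thy ∧ ψ ∉ w'.thy := by
  have hs' := imp_mem_sentences.1 hs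
  obtain ⟨w', h1, h2, h3, h4, h5⟩ := exists_extension w le_rfl hs'.1 hs'.2.1
    (fun c hc => Or.inl (hs'.2.2 c hc).2) (fun B hB hR => by
      obtain ⟨E, rfl, hp⟩ := hR.exists_of_eq rfl
      rw [addAt_self] at hp
      exact h (mem_of_proves hs (.intro hs'.1.1 (hp.mp ((proves hB).mono (Set.subset_insert _ _))))))
  refine ⟨w', le_of_exists_extension h1 h2 h3, ?_, h5⟩
  rwa [thy, h1]

theorem exists_le_of_all_notMem {x : ℕ} (hs : all x φ ∈ sentences w.dom) (h : all x φ ∉ w.thy) :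
    ∃ w', w ≤ w' ∧ ∃ c ∈ w'.dom, φ.subst x c ∉ w'.thy := by
  -- A counterexample of the next stage: outside the domain of `w`, hence an eigenvariable, but
  -- inside the domain of the extension.
  obtain ⟨c, hc1, hc2⟩ := (S.infinite_fiber w.depth (w.stage + 1)).nonempty
  have hc : c ∉ w.dom := fun hc => absurd hc.2 (by omega)
  obtain ⟨w', h1, h2, h3, h4, h5⟩ := exists_extension (φ := top) (ψ := φ.subst x c) w le_rfl
    top_mem_sentences (isSentence_all.1 hs.1).isSentence_subst (fun d hd => by
      rcases hd.of_subst with hd | rfl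
      · exact Or.inl (hs.2 d hd).2
      · exact Or.inr hc1.ge) (fun B hB hR => by
      obtain ⟨E, rfl, hp⟩ := hR.exists_of_eq rfl
      rw [addAt_self] at hp
      have hp' : Proves w.thy (φ.subst x c) :=
        (Proves.intro isSentence_top (hp.mp ((proves hB).mono (Set.subset_insert _ _)))).mp (.of_thm Thm.top)
      exact h (mem_of_proves hs (hp'.all_intro (fun γ hγ hγc => hc ((w.thy_sub hγ).2 c hγc))
        fun hφ => hc (hs.2 c hφ))))
  exact ⟨w', le_of_exists_extension h1 h2 h3, c, ⟨by omega, by omega⟩, h5⟩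

/-- The history is enlarged and lengthened in one go; `w'` is the result without its last theory. -/
theorem exists_M_of_box_notMem (hs : box φ ∈ sentences w.dom) (h : box φ ∉ w.thy) :
    ∃ w' v, w ≤ w' ∧ w'.M v ∧ φ ∉ v.thy := by
  have hs' : φ ∈ sentences w.dom := box_mem_sentences.1 hs
  obtain ⟨v, h1, h2, h3, h4, h5⟩ := exists_extension (φ := top) (ψ := φ) w (Nat.le_succ _)
    top_mem_sentences hs'.1 (fun d hd => Or.inl (hs'.2 d hd).2) (fun B hB hR => by
      obtain ⟨D, hD, hR, hp⟩ := hR.exists_of_lt (Nat.lt_succ_self _)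
      obtain ⟨E, rfl, hp'⟩ := hR.exists_of_eq rfl
      -- The new place starts out empty, so `D → φ` is a theorem and `□D` yields `□φ`.
      rw [addAt_of_ne (by omega), w.chain.eq_empty _ (Nat.lt_succ_self _)] at hp'
      rw [addAt_self] at hp
      have hp'' : Proves w.thy (box D) :=
        (Proves.intro isSentence_top (hp.mp ((proves hB).mono (Set.subset_insert _ _)))).mp (.of_thm Thm.top)
      exact h (mem_of_proves hs (hp''.box_mono hp'.thm)))
  exact ⟨v.truncate w.depth (by omega), v, le_truncate _ rfl (by omega)
    fun i hi => h3 i (by omega), M_truncate v _ h1, h5⟩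

theorem exists_root {Γ : Set (Formula σ)} (hΓ : Γ ⊆ sentences (S.consts 0 0))
    (hφ : φ ∈ sentences (S.consts 0 0)) (h : ¬ Proves Γ φ) :
    ∃ w : S.World, Γ ⊆ w.thy ∧ φ ∉ w.thy := by
  -- The data use stage 0 only, so the root is built at stage 1, whose constants are all fresh.
  have hext : Extendible (S.consts 1) 0 {φ} fun _ => Γ := by
    refine ⟨fun i _ => hΓ.trans (sentences_mono (S.consts_mono (by omega) (by omega))),
      fun hR => ?_, fun i hi => (S.infinite_fiber i 1).mono ?_⟩
    · obtain ⟨E, rfl, hp⟩ := hR.exists_of_eq rfl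
      exact h (hp.mp (.of_thm Thm.top))
    · rintro c ⟨h1, h2⟩
      have hc : c ∉ S.consts 0 0 := fun hc => absurd hc.2 (by omega)
      refine ⟨⟨h1.le, h2.le⟩, S.notMem_constsBelow h1, fun _ γ hγ hγc => hc ((hΓ hγ).2 c hγc), ?_⟩
      rintro E rfl hE
      exact hc (hφ.2 c hE)
  obtain ⟨T, hT, hsub, hN⟩ := hext.exists_primeChain (S.monotone_consts _)
    (impDirected_singleton hφ.1)
    (by rintro E rfl; exact hφ.1) ⟨φ, rfl⟩
  exact ⟨⟨0, 1, T, hT⟩, hsub 0 le_rfl, hN φ rfl⟩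

/-! ### Equality and congruence in the theory of a world -/

theorem eq_symm {a b : σ.Const} (h : eq (.const a) (.const b) ∈ w.thy) :
    eq (.const b) (.const a) ∈ w.thy := by
  have hs := (w.thy_sub h).2
  have hsub := Thm.id_sub 0 (eq (.var 0) (.const a)) a b (by simp [FreeOnlyIn, freeVars,
    Term.freeVars]) trivial
  simp only [subst, Term.subst, if_true] at hsub
  refine mem_of_proves ⟨rfl, fun c hc => hs c (Or.symm hc)⟩ ?_
  exact ((proves h).mp_thm hsub).mp (.of_thm (Thm.id_refl a))

theorem eq_trans {a b c : σ.Const} (h : eq (.const a) (.const b) ∈ w.thy)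
    (h' : eq (.const b) (.const c) ∈ w.thy) : eq (.const a) (.const c) ∈ w.thy := by
  have hs := (w.thy_sub h).2
  have hs' := (w.thy_sub h').2
  have hsub := Thm.id_sub 0 (eq (.const a) (.var 0)) b c (by simp [FreeOnlyIn, freeVars,
    Term.freeVars]) trivial
  simp only [subst, Term.subst, if_true] at hsub
  refine mem_of_proves ⟨rfl, fun d hd => hd.elim (fun h => hs d (Or.inl h))
    fun h => hs' d (Or.inr h)⟩ ?_
  exact ((proves h').mp_thm hsub).mp (proves h)

theorem isSentence_rel_const (P : σ.Pred) (a : Fin (σ.arity P) → σ.Const) :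
    (rel P fun i => .const (a i)).IsSentence := by
  refine Finset.eq_empty_of_forall_notMem fun y hy => ?_
  simp [freeVars, Term.freeVars] at hy

theorem rel_congr {P : σ.Pred} {a b : Fin (σ.arity P) → σ.Const}
    (h : ∀ i, eq (.const (a i)) (.const (b i)) ∈ w.thy)
    (ha : (rel P fun i => .const (a i)) ∈ w.thy) : (rel P fun i => .const (b i)) ∈ w.thy := by
  -- The substitution axiom handles one pair of constants at a time, so the arguments are exchanged
  -- coordinate by coordinate, `F` being the set already exchanged.
  suffices ∀ F : Finset (Fin (σ.arity P)),
      (rel P fun i => .const (if i ∈ F then b i else a i)) ∈ w.thy by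
    simpa using this Finset.univ
  intro F
  induction F using Finset.induction_on with
  | empty => simpa using ha
  | @insert i F hi ih =>
    have hsub := Thm.id_sub 0
      (rel P fun j => if j = i then .var 0 else .const (if j ∈ F then b j else a j)) (a i) (b i) (by
        simp only [FreeOnlyIn, freeVars, Finset.biUnion_subset]
        intro j _
        by_cases hj : j = i <;> simp [hj, Term.freeVars]) trivial
    have e1 : (fun j => Term.subst 0 (a i) (if j = i then .var 0 else
        (.const (if j ∈ F then b j else a j) : Term σ))) =
        fun j => .const (if j ∈ F then b j else a j) := by
      funext j
      by_cases hj : j = i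
      · subst hj; simp [Term.subst, hi]
      · simp [Term.subst, hj]
    have e2 : (fun j => Term.subst 0 (b i) (if j = i then .var 0 else
        (.const (if j ∈ F then b j else a j) : Term σ))) =
        fun j => .const (if j ∈ insert i F then b j else a j) := by
      funext j
      by_cases hj : j = i
      · subst hj; simp [Term.subst]
      · simp [Term.subst, hj]
    simp only [subst, e1, e2] at hsub
    refine mem_of_proves ⟨isSentence_rel_const P _, fun c hc => ?_⟩
      (((proves (h i)).mp_thm hsub).mp (proves ih))
    obtain ⟨j, hj⟩ := hc
    rw [← show _ = c from hj]
    split_ifs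
    · exact (w.thy_sub (h j)).2 _ (Or.inr rfl)
    · exact (w.thy_sub (h j)).2 _ (Or.inl rfl)

end World

/-- The canonical model. -/
def canonicalModel : Model.{u} σ where
  World := S.World
  order := inferInstance
  M := World.M
  fc1 _ _ _ h hv := World.exists_M_of_le h hv
  fc2 _ _ _ hw h := World.exists_le_of_M h hw
  Elem := σ.Const
  D := World.dom
  D_le _ _ h := World.dom_subset h
  D_M _ _ h := h.dom_subset
  E w a b := eq (.const a) (.const b) ∈ w.thy
  E_dom w a b h := ⟨(w.thy_sub h).2 a (Or.inl rfl), (w.thy_sub h).2 b (Or.inr rfl)⟩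
  E_refl _ a ha := World.mem_of_proves
    ⟨rfl, fun _ hc => hc.elim (fun h => h ▸ ha) fun h => h ▸ ha⟩ (.of_thm (Thm.id_refl a))
  E_symm _ _ _ h := World.eq_symm h
  E_trans _ _ _ _ h h' := World.eq_trans h h'
  E_le _ _ _ _ h := fun hm => World.thy_subset h hm
  constI := S.emb
  constI_mem c _ := S.emb_mem_consts c _ _
  predI w P := {a | (rel P fun i => .const (a i)) ∈ w.thy}
  predI_dom w _ _ ha i := (w.thy_sub ha).2 _ ⟨i, rfl⟩
  predI_le _ _ _ h := fun _ ha => World.thy_subset h ha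
  predI_E _ _ _ _ h ha := World.rel_congr h ha

/-! ### The truth lemma -/

/-- The formula in the language of the canonical model, with its free variables replaced by their
values. -/
def eval (g : ℕ → σ.Const) (φ : Formula σ) : Formula σ := (φ.rename S.emb).inst fun x => some (g x)

theorem eval_mem_sentences {w : S.World} {g : ℕ → σ.Const} (hg : ∀ x, g x ∈ w.dom)
    (φ : Formula σ) : S.eval g φ ∈ sentences w.dom := by
  refine ⟨Finset.eq_empty_of_forall_notMem fun y hy => ?_, fun c hc => ?_⟩
  · simpa using (mem_freeVars_inst.1 hy).2
  · rcases hc.of_inst with h | ⟨x, hx⟩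
    · obtain ⟨d, -, rfl⟩ := hasConst_rename.1 h
      exact S.emb_mem_consts d _ _
    · obtain rfl : g x = c := by simpa using hx
      exact hg x

theorem eval_eq_rename (g : ℕ → σ.Const) {φ : Formula σ} (hφ : φ.IsSentence) :
    S.eval g φ = φ.rename S.emb := by
  refine inst_eq_self fun x hx => ?_
  rw [freeVars_rename, show φ.freeVars = ∅ from hφ] at hx
  simp at hx

theorem subst_inst_update (g : ℕ → σ.Const) (x : ℕ) (a : σ.Const) (φ : Formula σ) :
    ((φ.rename S.emb).inst (Function.update (fun y => some (g y)) x none)).subst x a =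
      S.eval (Function.update g x a) φ := by
  rw [inst_subst, eval]
  congr 1
  funext y
  by_cases hy : y = x
  · subst hy; simp
  · simp [hy]

theorem term_inst_rename (g : ℕ → σ.Const) (t : Term σ) :
    (t.rename S.emb).inst (fun x => some (g x)) = .const (S.canonicalModel.den g t) := by
  cases t <;> rfl

/-- Induction on `φ`. For `→`, `□` and `∀` a missing formula is refuted in an enlarged history; for
`◇` a successor is appended; `∨` and `∃` use primeness and saturation. -/
theorem sat_iff_mem (φ : Formula σ) (w : S.World) (g : ℕ → σ.Const) (hg : ∀ x, g x ∈ w.dom) :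
    S.canonicalModel.Sat w g φ ↔ S.eval g φ ∈ w.thy := by
  induction φ generalizing w g with
  | rel P ts => simp only [eval, rename, inst, term_inst_rename]; exact Iff.rfl
  | eq s t => simp only [eval, rename, inst, term_inst_rename]; exact Iff.rfl
  | and φ ψ h1 h2 =>
    exact (and_congr (h1 w g hg) (h2 w g hg)).trans (w.chain.and_mem le_rfl).symm
  | or φ ψ h1 h2 =>
    refine (or_congr (h1 w g hg) (h2 w g hg)).trans ⟨?_, w.chain.prime _ le_rfl _ _⟩
    have hs := or_mem_sentences.1 (S.eval_mem_sentences hg (φ.or ψ))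
    rintro (h | h)
    · exact World.mem_of_proves (or_mem_sentences.2 hs) ((World.proves h).or_left hs.2.1)
    · exact World.mem_of_proves (or_mem_sentences.2 hs) ((World.proves h).or_right hs.1.1)
  | imp φ ψ h1 h2 =>
    constructor
    · intro h
      by_contra hcon
      obtain ⟨w', hw, h3, h4⟩ := World.exists_le_of_imp_notMem
        (S.eval_mem_sentences hg (φ.imp ψ)) hcon
      have hg' := fun x => World.dom_subset hw (hg x)
      exact h4 ((h2 w' g hg').1 (h w' hw ((h1 w' g hg').2 h3)))
    · intro h w' hw hφ
      have hg' := fun x => World.dom_subset hw (hg x)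
      exact (h2 w' g hg').2 (World.mp (World.thy_subset hw h) ((h1 w' g hg').1 hφ))
  | box φ ih =>
    constructor
    · intro h
      by_contra hcon
      obtain ⟨w', v, hw, hv, h3⟩ := World.exists_M_of_box_notMem
        (S.eval_mem_sentences hg (box φ)) hcon
      exact h3 ((ih v g fun x => hv.dom_subset (World.dom_subset hw (hg x))).1 (h w' v hw hv))
    · intro h w' v hw (hv : World.M w' v)
      exact (ih v g fun x => hv.dom_subset (World.dom_subset hw (hg x))).2
        (hv.mem_of_box (World.thy_subset hw h))
  | dia φ ih =>
    constructor
    · rintro ⟨v, hv, h⟩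
      have hv : World.M w v := hv
      exact hv.dia_mem (S.eval_mem_sentences hg φ) ((ih v g fun x => hv.dom_subset (hg x)).1 h)
    · intro h
      obtain ⟨v, hv, h⟩ := World.exists_M_of_dia h
      exact ⟨v, hv, (ih v g fun x => hv.dom_subset (hg x)).2 h⟩
  | all x φ ih =>
    have hs := S.eval_mem_sentences hg (all x φ)
    have hup : ∀ w', w ≤ w' → ∀ a ∈ w'.dom, ∀ y, Function.update g x a y ∈ w'.dom := by
      intro w' hw a ha y
      by_cases hy : y = x
      · subst hy; simpa using ha
      · simpa [hy] using World.dom_subset hw (hg y)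
    constructor
    · intro h
      by_contra hcon
      obtain ⟨w', hw, c, hc, h3⟩ := World.exists_le_of_all_notMem hs hcon
      rw [subst_inst_update] at h3
      exact h3 ((ih w' _ (hup w' hw c hc)).1 (h w' hw c hc))
    · intro h (w' : S.World) hw (a : σ.Const) ha
      refine (ih w' _ (hup w' hw a ha)).2 ?_
      rw [← subst_inst_update]
      have h' := World.thy_subset hw h
      exact World.mem_of_proves (subst_mem_sentences (World.thy_sub w' h') ha)
        ((World.proves h').mp_thm (Thm.univ x _ a (isSentence_all.1 hs.1)))
  | ex x φ ih =>
    have hs := S.eval_mem_sentences hg (ex x φ)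
    have hup : ∀ a ∈ w.dom, ∀ y, Function.update g x a y ∈ w.dom := by
      intro a ha y
      by_cases hy : y = x
      · subst hy; simpa using ha
      · simpa [hy] using hg y
    constructor
    · rintro ⟨(a : σ.Const), ha, h⟩
      have h' := (ih w _ (hup a ha)).1 h
      rw [← subst_inst_update] at h'
      exact World.mem_of_proves hs
        ((World.proves h').mp_thm (Thm.exist x _ a (isSentence_ex.1 hs.1)))
    · intro h
      obtain ⟨a, ha, h⟩ := w.chain.witness _ le_rfl _ _ h
      rw [subst_inst_update] at h
      exact ⟨a, ha, (ih w _ (hup a ha)).2 h⟩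
  | bot => exact ⟨False.elim, w.chain.bot_notMem _ le_rfl⟩

end Stratification

/-- Derivations are stable under arbitrary renamings, so a left inverse of `f` carries the
derivation back. -/
theorem proves_of_rename {Γ : Set (Formula σ)} {φ : Formula σ} {f : σ.Const → σ.Const}
    (hf : Function.Injective f) (h : Proves (Formula.rename f '' Γ) (φ.rename f)) :
    Proves Γ φ := by
  have := σ.infinite_const
  have key : ∀ ψ : Formula σ, (ψ.rename f).rename (Function.invFun f) = ψ := fun ψ => by
    rw [rename_rename, Function.invFun_comp hf, rename_id]
  have h' := h.rename (Function.invFun f)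
  rw [key, Set.image_image] at h'
  simpa only [key, Set.image_id'] using h'

end FOFS

theorem mainTheorem1 (σ : FOFS.Signature.{u}) (Γ : Set (FOFS.Formula σ))
    (hΓ : ∀ γ ∈ Γ, γ.IsSentence) (φ : FOFS.Formula σ) (hφ : φ.IsSentence)
    (h : FOFS.Entails Γ φ) : FOFS.Proves Γ φ := by
  obtain ⟨S⟩ := FOFS.nonempty_stratification σ
  refine FOFS.proves_of_rename S.emb_injective ?_
  by_contra hcon
  have hsent : ∀ ψ : FOFS.Formula σ, ψ.IsSentence →
      ψ.rename S.emb ∈ FOFS.Formula.sentences (S.consts 0 0) := fun ψ hψ =>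
    ⟨by rwa [FOFS.Formula.IsSentence, FOFS.Formula.freeVars_rename], fun c hc => by
      obtain ⟨d, -, rfl⟩ := FOFS.Formula.hasConst_rename.1 hc
      exact S.emb_mem_consts d 0 0⟩
  obtain ⟨w, h1, h2⟩ := FOFS.Stratification.World.exists_root (S := S)
    (Set.image_subset_iff.2 fun γ hγ => hsent γ (hΓ γ hγ)) (hsent φ hφ) hcon
  have := σ.infinite_const
  obtain ⟨c⟩ : Nonempty σ.Const := inferInstance
  -- Some assignment is needed to apply the truth lemma; for a sentence any choice gives the same
  -- result.
  have hg : ∀ x : ℕ, (fun _ : ℕ => S.emb c) x ∈ w.dom := fun _ => S.emb_mem_consts c _ _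
  refine h2 ?_
  rw [← S.eval_eq_rename (fun _ => S.emb c) hφ, ← S.sat_iff_mem φ w _ hg]
  refine h S.canonicalModel w (fun γ hγ g hgw => ?_) _ hg
  rw [S.sat_iff_mem γ w g hgw, S.eval_eq_rename g (hΓ γ hγ)]
  exact h1 ⟨γ, hγ, rfl⟩
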